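/- **Setting.** For a finite simple graph $G=(V,E)$, a configuration $\sigma\in\{+1,-1\}^V$ has size $|\sigma|^+=|\sigma^{-1}(+1)|$, and $m_G(\sigma)$ denotes its number of monochromatic edges. For $U\subseteq V$, a pinning is a map $\tau_U:U\to\{+1,-1\}$, and $\Omega^{\tau_U}$ is the set of configurations that agree with $\tau_U$ on $U$. Put $$Z_G^{\tau_U}(\beta,\lambda)=\sum_{\sigma\in\Omega^{\tau_U}}\lambda^{|\sigma|^+}e^{\beta m_G(\sigma)},\qquad \mu^{\tau_U}_{G,\beta,\lambda}(\sigma)=\frac{\mathbf 1[\sigma\in\Omega^{\tau_U}]\,\lambda^{|\sigma|^+}e^{\beta m_G(\sigma)}}{Z_G^{\tau_U}(\beta,\lambda)} .$$ Let $\mathcal G_\Delta$ be the class of finite graphs of maximum degree at most $\Delta$. Given $\beta\ge 0$, $\Delta\in\mathbb N$, $\lambda>0$ and $\delta>0$, the Ising model is absolutely $\delta$-zero-free at activity $\lambda$ if $Z_G^{\tau_U}(\beta,\lambda')\ne 0$ for all $G=(V,E)\in\mathcal G_\Delta$, all $U\subseteq V$, all pinnings $\tau_U$ and all $\lambda'\in\mathbb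 C$ with $|\lambda'-\lambda|<\delta$. **Theorem.** Let $\Delta\in\mathbb N$ and $\beta\ge 0$, let $D\subset\mathbb R_{>0}$ be compact, and let $\delta>0$ be such that the Ising model is absolutely $\delta$-zero-free at every $\lambda\in D$. Let $\alpha\in[0,1)$. Let $\lambda\in D$, let $G=(V,E)\in\mathcal G_\Delta$ with $n=|V|\ge 1$, let $U\subseteq V$ with $|U|\le\alpha n$, and let $\tau_U$ be a pinning of $U$. Let $X=|\sigma|^+$ for $\sigma\sim\mu^{\tau_U}_{G,\beta,\lambda}$, let $s=\sqrt{\mathrm{Var}(X)}$, and let $\ell\in\mathbb R$ be such that $\mathbb E[X]+\ell\in\mathbb Z_{\ge 0}$. Let $\kappa_j(X)=\frac{d^j}{dt^j}\log\mathbb E[e^{tX}]\big|_{t=0}$ be the $j$th cumulant, let $\beta_j=\frac{\kappa_j(X)}{j!\,s^j}$, and let $H_r$ be the $r$th (probabilists') Hermite polynomial. 1. For every integer $d\ge 0$, $$\mathbb P(X-\mathbb E[X]=\ell)=\frac{e^{-\ell^2/(2s^2)}}{\sqrt{2\pi}\,s}\left(1+\sum_{r\ge 3}H_r(\ell/s)\sum_{k_3,\dots,k_{2d+1}}\prod_{j=3}^{2d+1}\frac{\beta_j^{k_j}}{k_j!}\right)+O(n^{-d}),$$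 where the inner sum is over tuples $k_3,\dots,k_{2d+1}\in\mathbb Z_{\ge 0}$ with $\sum_j k_j\, j=r$ and $\sum_j k_j\frac{j-2}{2}\le d$, and the implied constant depends only on $\Delta,\beta,\delta,D,d$ and $\alpha$. 2. For every $L\in\mathbb Z_{\ge 0}$, if moreover $|\ell|\le L$, then $$\mathbb P(X-\mathbb E[X]=\ell)=\frac{e^{-\ell^2/(2s^2)}}{\sqrt{2\pi}\,s}+O(n^{-3/2}),$$ where the implied constant depends only on $\Delta,\beta,\delta,D,L$ and $\alpha$. -/

import Mathlib

open MeasureTheory ProbabilityTheory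

universe u

noncomputable section

/-- A spin, `+1` or `-1`. -/
abbrev Spin : Type := Bool

/-- The spin `+1` is `true`, the spin `-1` is `false`. -/
abbrev Spin.plus : Spin := true

/-- `|σ|⁺`, the number of vertices with spin `+1`. -/
def plusCount {V : Type u} [Fintype V] (σ : V → Spin) : ℕ :=
  (Finset.univ.filter fun v => σ v = Spin.plus).card

/-- `m_G(σ)`, the number of monochromatic edges: those whose image under `σ` is a diagonal
pair. -/
def monoEdges {V : Type u} (G : SimpleGraph V) (σ : V → Spin) : ℕ :=
  {e : Sym2 V | e ∈ G.edgeSet ∧ (e.map σ).IsDiag}.ncard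

/-- `G` has maximum degree at most `Δ`. For finite `V`, which is the only case used, `ncard` is
the true cardinality. -/
def DegreeAtMost {V : Type u} (G : SimpleGraph V) (Δ : ℕ) : Prop :=
  ∀ v, (G.neighborSet v).ncard ≤ Δ

/-- `Ω^{τ_U}`, the set of configurations that agree with the pinning `τ` on `U`. -/
def pinnedConfigs {V : Type u} [Fintype V] [DecidableEq V] {U : Finset V} (τ : U → Spin) :
    Finset (V → Spin) :=
  Finset.univ.filter fun σ => ∀ v : U, σ v = τ v

/-- The weight `z^{|σ|⁺} e^{β m_G(σ)}`, for a real or complex activity `z`. -/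
def isingWeight {V : Type u} [Fintype V] (𝕜 : Type) [RCLike 𝕜]
    (G : SimpleGraph V) (β : ℝ) (z : 𝕜) (σ : V → Spin) : 𝕜 :=
  z ^ plusCount σ * ((Real.exp (β * (monoEdges G σ : ℝ)) : ℝ) : 𝕜)

/-- The pinned partition function `Z_G^{τ_U}(β, z)`. -/
def isingZ {V : Type u} [Fintype V] [DecidableEq V] (𝕜 : Type) [RCLike 𝕜]
    (G : SimpleGraph V) (β : ℝ) (z : 𝕜) {U : Finset V} (τ : U → Spin) : 𝕜 :=
  ∑ σ ∈ pinnedConfigs τ, isingWeight 𝕜 G β z σ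

/-- The Ising Gibbs measure `μ_{G,β,lam}^{τ_U}` with pinning `τ`. -/
def isingMeasure {V : Type u} [Fintype V] [DecidableEq V]
    (G : SimpleGraph V) (β lam : ℝ) {U : Finset V} (τ : U → Spin) : Measure (V → Spin) :=
  ∑ σ ∈ pinnedConfigs τ,
    ENNReal.ofReal (isingWeight ℝ G β lam σ / isingZ ℝ G β lam τ) • Measure.dirac σ

/-- The Ising model with parameters `β`, `Δ` is absolutely `δ`-zero-free at activity `lam`: no
pinned partition function of a finite graph of maximum degree at most `Δ` vanishes in the open
complex disc of radius `δ` around `lam`. -/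
def AbsolutelyZeroFree (Δ : ℕ) (β δ lam : ℝ) : Prop :=
  ∀ (V : Type u) [Fintype V] [DecidableEq V] (G : SimpleGraph V), DegreeAtMost G Δ →
    ∀ (U : Finset V) (τ : U → Spin), ∀ z ∈ Metric.ball (lam : ℂ) δ, isingZ ℂ G β z τ ≠ 0

/-- The random variable `X`, the number of `+1` spins. -/
def plusVar {V : Type u} [Fintype V] (σ : V → Spin) : ℝ := (plusCount σ : ℝ)

/-- The `j`-th cumulant `κ_j(X)`, the `j`-th derivative at `0` of `t ↦ log E[exp (t X)]`. -/
def cumulant {Ω : Type u} [MeasurableSpace Ω] (X : Ω → ℝ) (μ : Measure Ω) (j : ℕ) : ℝ :=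
  iteratedDeriv j (cgf X μ) 0

/-- The normalized cumulant `β_j = κ_j(X) / (j! s^j)`, where `s` is the standard deviation. -/
def normCumulant {Ω : Type u} [MeasurableSpace Ω] (X : Ω → ℝ) (μ : Measure Ω) (j : ℕ) : ℝ :=
  cumulant X μ j / ((j.factorial : ℝ) * √(variance X μ) ^ j)

/-- The conditions on the tuple `k = (k_3, …, k_{2d+1})` of nonnegative integers:
`∑ j k_j = r` and `∑ k_j (j - 2) / 2 ≤ d`. -/
def IsEdgeworthTuple (d r : ℕ) (k : Finset.Icc 3 (2 * d + 1) → ℕ) : Prop :=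
  ∑ j, k j * (j : ℕ) = r ∧ ∑ j, (k j : ℚ) * ((((j : ℕ) : ℚ) - 2) / 2) ≤ (d : ℚ)

open Classical in
/-- All tuples with `IsEdgeworthTuple d r`, as a finite set; see `mem_edgeworthTuples`. -/
def edgeworthTuples (d r : ℕ) : Finset (Finset.Icc 3 (2 * d + 1) → ℕ) :=
  (Fintype.piFinset fun _ => Finset.range (r + 1)).filter (IsEdgeworthTuple d r)

theorem mem_edgeworthTuples {d r : ℕ} {k : Finset.Icc 3 (2 * d + 1) → ℕ} :
    k ∈ edgeworthTuples d r ↔ IsEdgeworthTuple d r k := by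
  classical
  unfold edgeworthTuples
  rw [Finset.mem_filter, and_iff_right_iff_imp]
  rintro ⟨h, -⟩
  rw [Fintype.mem_piFinset]
  intro j
  have h1 : k j * (j : ℕ) ≤ r := by
    rw [← h]
    exact Finset.single_le_sum (f := fun j : Finset.Icc 3 (2 * d + 1) => k j * (j : ℕ))
      (fun _ _ => Nat.zero_le _) (Finset.mem_univ j)
  have h2 : 3 ≤ (j : ℕ) := (Finset.mem_Icc.1 j.2).1
  rw [Finset.mem_range]
  nlinarith

/-- The sum over all `r ≥ 3` has no terms with `r > 6 d`. -/
theorem edgeworthTuples_eq_empty {d r : ℕ} (h : 6 * d < r) : edgeworthTuples d r = ∅ := by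
  rw [Finset.eq_empty_iff_forall_notMem]
  intro k hk
  obtain ⟨h1, h2⟩ := mem_edgeworthTuples.1 hk
  have h3 : ((r : ℕ) : ℚ) ≤ 6 * ∑ j, (k j : ℚ) * ((((j : ℕ) : ℚ) - 2) / 2) := by
    rw [← h1, Finset.mul_sum]
    push_cast
    refine Finset.sum_le_sum fun j _ => ?_
    have h4 : (3 : ℚ) ≤ ((j : ℕ) : ℚ) := by exact_mod_cast (Finset.mem_Icc.1 j.2).1
    have h5 : (0 : ℚ) ≤ (k j : ℚ) := Nat.cast_nonneg _
    nlinarith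
  have h6 : ((6 * d : ℕ) : ℚ) < r := by exact_mod_cast h
  push_cast at h6
  linarith

/-- The correction
`∑_{r ≥ 3} H_r(x) ∑_{k_3, …, k_{2d+1}} ∏_{j=3}^{2d+1} β_j^{k_j} / k_j!`
of order `d`, with `H_r` the probabilists' Hermite polynomial. The sum over `r ≥ 3` stops at
`6 d` because later terms are empty, by `edgeworthTuples_eq_empty`. -/
def edgeworthCorrection {Ω : Type u} [MeasurableSpace Ω] (X : Ω → ℝ) (μ : Measure Ω)
    (d : ℕ) (x : ℝ) : ℝ :=
  ∑ r ∈ Finset.Icc 3 (6 * d), Polynomial.aeval x (Polynomial.hermite r) *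
    ∑ k ∈ edgeworthTuples d r, ∏ j : Finset.Icc 3 (2 * d + 1),
      normCumulant X μ (j : ℕ) ^ k j / ((k j).factorial : ℝ)

/-- The density `e^{-ℓ²/(2s²)} / (√(2π) s)`. -/
def gaussianDensity (s ℓ : ℝ) : ℝ :=
  Real.exp (-(ℓ ^ 2 / (2 * s ^ 2))) / (√(2 * Real.pi) * s)

end

/-! Fourier inversion writes `P(X = m)` as the integral over `[-π, π]` of `E[e^{itX}] e^{-itm} /
(2π)`. Two inputs control the characteristic function.

Cumulants: `E[e^{zX}] = Z(λe^z)/Z(λ)`, so zero-freeness makes it nonvanishing on a disc of fixed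
radius `r`. Its logarithm is analytic there with real part at most `nr`. Borel–Carathéodory and
Cauchy then give `|κ_j|/j! ≤ 2nr/(r/2)^j`, linear in `n` for every `j` (`cumulant_expansion`).

Decay: bounded degree yields an independent set `I` outside `U` with at least `(n - |U|)/(Δ+1)`
vertices. Given the other spins, those in `I` are independent and nondegenerate, so `|E[e^{itX}]| ≤
e^{-cnt²}` for `|t| ≤ π` (`norm_sum_mul_prod_le`, `norm_complexMGF_isingMeasure_le`). Letting `t →
0` also gives `Var X ≥ 2cn`.

Near `0` the centred characteristic function is `e^{-s²t²/2}` times the exponential of `∑_{j≥3} κ_j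
(it)^j / j!`. Each term of that sum is split into `|t|^{j-2}`, counted towards the order, and a
multiple of `nt²`, absorbed by the Gaussian. Truncating the exponential at weight `∑ k_j (j-2) ≤ 2d`
leaves an error of order `(|t|^{2d+1} + n|t|^{2d+2}) e^{-cnt²/4}`, which integrates to
`O(n^{-d-1/2})`. The Fourier integral of the Gaussian times `(it)^r` produces `H_r`. This is
`exists_local_limit_bound`.

For bounded `ℓ` take `d = 1`: the correction consists of an `H_3` and an `H_6` term, each `O(1/n)`,
times a density `O(n^{-1/2})`. -/

/-! ### Analytic logarithms and cumulant bounds. -/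

/-- A primitive of `f'/f` exists on the disc, and `e^{-g} f` has zero derivative. -/
theorem Complex.exists_log_of_ne_zero_on_ball {f : ℂ → ℂ} {r : ℝ} (hr : 0 < r)
    (hf : DifferentiableOn ℂ f (Metric.ball 0 r)) (hne : ∀ z ∈ Metric.ball 0 r, f z ≠ 0)
    (h0 : f 0 = 1) :
    ∃ g : ℂ → ℂ, DifferentiableOn ℂ g (Metric.ball 0 r) ∧ g 0 = 0 ∧
      ∀ z ∈ Metric.ball 0 r, Complex.exp (g z) = f z := by
  have hd : DifferentiableOn ℂ (fun z => deriv f z / f z) (Metric.ball 0 r) :=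
    (hf.deriv Metric.isOpen_ball).div hf hne
  obtain ⟨g, hg⟩ := hd.isExactOn_ball
  have h00 : (0 : ℂ) ∈ Metric.ball (0 : ℂ) r := Metric.mem_ball_self hr
  refine ⟨fun z => g z - g 0,
    fun z hz => ((hg z hz).differentiableAt.sub_const _).differentiableWithinAt, sub_self _, ?_⟩
  have hder : ∀ z ∈ Metric.ball (0 : ℂ) r,
      HasDerivAt (fun z => Complex.exp (-(g z - g 0)) * f z) 0 z := by
    intro z hz
    have h1 := (((hg z hz).sub_const (g 0)).neg.cexp).mul
      (hf.differentiableAt (Metric.isOpen_ball.mem_nhds hz)).hasDerivAt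
    convert! h1 using 1
    field_simp [hne z hz]
    ring
  intro z hz
  have hc := Metric.isOpen_ball.is_const_of_deriv_eq_zero
    (convex_ball (0 : ℂ) r).isPreconnected
    (fun w hw => (hder w hw).differentiableAt.differentiableWithinAt)
    (fun w hw => (hder w hw).deriv) hz h00
  simp only [sub_self, neg_zero, Complex.exp_zero, one_mul, h0] at hc
  rw [Complex.exp_neg] at hc
  have := Complex.exp_ne_zero (g z - g 0)
  field_simp at hc
  exact hc.symm

/-- Identifies the Taylor coefficients of the complex logarithm with the cumulants, which are real
derivatives. The induction differentiates the identity, so it must be carried on a neighbourhood. -/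
theorem eventually_iteratedDeriv_ofReal_eq {g : ℂ → ℂ} {f : ℝ → ℝ} {x : ℝ}
    (hg : AnalyticAt ℂ g x) (h : ∀ᶠ t : ℝ in nhds x, g t = f t) (j : ℕ) :
    ∀ᶠ t : ℝ in nhds x, iteratedDeriv j g t = iteratedDeriv j f t := by
  induction j with
  | zero => simpa using h
  | succ j ih =>
    have hA : ∀ᶠ t : ℝ in nhds x, AnalyticAt ℂ g t :=
      (Complex.continuous_ofReal.tendsto x).eventually hg.eventually_analyticAt
    filter_upwards [ih.eventually_nhds, hA] with t ht hgt
    have h1 : HasDerivAt (iteratedDeriv j g) (iteratedDeriv (j + 1) g t) (t : ℂ) := by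
      rw [iteratedDeriv_succ]
      have : AnalyticAt ℂ (iteratedDeriv j g) t := by
        rw [iteratedDeriv_eq_iterate]; exact hgt.iterated_deriv j
      exact this.differentiableAt.hasDerivAt
    have h2 : HasDerivAt (iteratedDeriv j f) (iteratedDeriv (j + 1) g t).re t := by
      refine h1.real_of_complex.congr_of_eventuallyEq ?_
      filter_upwards [ht] with y hy
      rw [hy, Complex.ofReal_re]
    have h3 := h1.comp_ofReal.congr_of_eventuallyEq (ht.mono fun y hy => hy.symm)
    rw [h3.unique h2.ofReal_comp, iteratedDeriv_succ (f := f), h2.deriv]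

/-- Cumulant bounds and the cumulant expansion of a nonvanishing moment generating function. -/
theorem cumulant_expansion {Ω : Type u} [MeasurableSpace Ω] {X : Ω → ℝ} {μ : Measure Ω}
    [IsProbabilityMeasure μ] (hX : integrableExpSet X μ = Set.univ) {r A : ℝ} (hr : 0 < r)
    (hA : 0 < A) (hb : ∀ z ∈ Metric.ball (0 : ℂ) r, ‖complexMGF X μ z‖ ≤ Real.exp A)
    (hne : ∀ z ∈ Metric.ball (0 : ℂ) r, complexMGF X μ z ≠ 0) :
    (∀ j, |cumulant X μ j| ≤ j.factorial * (2 * A) / (r / 2) ^ j) ∧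
    ∀ z ∈ Metric.ball (0 : ℂ) (r / 2), ∃ S,
      HasSum (fun j : ℕ => ((cumulant X μ j / j.factorial : ℝ) : ℂ) * z ^ j) S ∧
        Complex.exp S = complexMGF X μ z := by
  have hdiff : Differentiable ℂ (complexMGF X μ) := fun z =>
    (hasDerivAt_complexMGF (by simp [hX])).differentiableAt
  have h1 : complexMGF X μ 0 = 1 := by simp [complexMGF]
  obtain ⟨g, hg, hg0, hge⟩ := Complex.exists_log_of_ne_zero_on_ball hr hdiff.differentiableOn hne h1
  have h00 : (0 : ℂ) ∈ Metric.ball (0 : ℂ) r := Metric.mem_ball_self hr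
  -- Since `|e^g| = e^{Re g}`, the bound on the moment generating function controls only `Re g`.
  have hre : Set.MapsTo g (Metric.ball 0 r) {z | z.re ≤ A} := by
    intro z hz
    have := hb z hz
    rw [← hge z hz, Complex.norm_exp, Real.exp_le_exp] at this
    exact this
  have hgan : AnalyticAt ℂ g ((0 : ℝ) : ℂ) := by
    rw [Complex.ofReal_zero]
    exact hg.analyticAt (Metric.isOpen_ball.mem_nhds h00)
  -- Near `0` the imaginary part of `g` lies in `(-π, π)`, so `g` is the principal logarithm.
  have heq : ∀ᶠ t : ℝ in nhds 0, g t = (cgf X μ t : ℂ) := by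
    have hev : ∀ᶠ z in nhds ((0 : ℝ) : ℂ), z ∈ Metric.ball (0 : ℂ) r ∧ ‖g z‖ < Real.pi := by
      rw [Complex.ofReal_zero]
      refine Filter.Eventually.and (Metric.isOpen_ball.mem_nhds h00) ?_
      have hc : ContinuousAt g 0 := by simpa using hgan.continuousAt
      have := hc.norm.tendsto
      rw [hg0, norm_zero] at this
      exact this.eventually (gt_mem_nhds Real.pi_pos)
    have hev' := (Complex.continuous_ofReal.tendsto 0).eventually hev
    filter_upwards [hev'] with t ⟨ht, htp⟩
    have him := (Complex.abs_im_le_norm (g t)).trans_lt htp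
    rw [abs_lt] at him
    rw [← Complex.log_exp him.1 him.2.le, hge _ ht, complexMGF_ofReal,
      ← Complex.ofReal_log mgf_nonneg]
    rfl
  have hcum : ∀ j, iteratedDeriv j g 0 = (cumulant X μ j : ℂ) := fun j => by
    have := (eventually_iteratedDeriv_ofReal_eq hgan heq j).self_of_nhds
    simpa [cumulant] using this
  have hr2 : 0 < r / 2 := by positivity
  have hsub : Metric.closedBall (0 : ℂ) (r / 2) ⊆ Metric.ball 0 r :=
    Metric.closedBall_subset_ball (by linarith)
  refine ⟨fun j => ?_, fun z hz => ?_⟩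
  -- Cauchy's estimate on `‖z‖ = r/2`, where the Borel–Carathéodory bound `2A‖z‖/(r - ‖z‖)` equals
  -- `2A`.
  · have := Complex.norm_iteratedDeriv_le_of_forall_mem_sphere_norm_le (c := 0) (R := r / 2)
      (C := 2 * A) (f := g) j hr2 ?_ ?_
    · rwa [hcum, Complex.norm_real] at this
    · refine DifferentiableOn.diffContOnCl ?_
      rw [closure_ball _ hr2.ne']
      exact hg.mono hsub
    · intro z hz
      have hz' : ‖z‖ = r / 2 := by simpa using hz
      refine (Complex.borelCaratheodory_zero hA hg hre hr
        (hsub (Metric.sphere_subset_closedBall hz)) hg0).trans_eq ?_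
      rw [hz']; field_simp; ring
  · have hz' := hsub (Metric.ball_subset_closedBall hz)
    refine ⟨g z, ?_, hge z hz'⟩
    have := Complex.hasSum_taylorSeries_on_ball hg hz'
    convert! this using 2 with j
    rw [hcum, sub_zero, smul_eq_mul, smul_eq_mul]
    push_cast
    ring

/-! ### Truncating the exponential series by weight. -/

section ExpTruncation

variable {ι : Type*} [Fintype ι]

set_option linter.unusedVariables false in
theorem norm_prod_pow_div_factorial_le {x : ι → ℂ} {y : ι → ℝ} {θ : ℝ} (hθ : 0 ≤ θ) {w : ι → ℕ}
    (hxy : ∀ i, ‖x i‖ ≤ θ ^ w i * y i) (k : ι → ℕ) :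
    ‖∏ i, x i ^ k i / ((k i).factorial : ℂ)‖ ≤
      θ ^ (∑ i, k i * w i) * ∏ i, y i ^ k i / ((k i).factorial : ℝ) := by
  rw [norm_prod, ← Finset.prod_pow_eq_pow_sum, ← Finset.prod_mul_distrib]
  refine Finset.prod_le_prod (fun i _ => norm_nonneg _) fun i _ => ?_
  rw [norm_div, norm_pow, Complex.norm_natCast, mul_comm (k i), pow_mul, ← mul_div_assoc,
    ← mul_pow]
  gcongr
  exact hxy i

theorem sum_prod_pow_div_factorial_le_exp [DecidableEq ι] {y : ι → ℝ} (hy : ∀ i, 0 ≤ y i)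
    (T : Finset (ι → ℕ)) :
    ∑ k ∈ T, ∏ i, y i ^ k i / ((k i).factorial : ℝ) ≤ Real.exp (∑ i, y i) := by
  obtain ⟨N, hN⟩ : ∃ N, T ⊆ Fintype.piFinset fun _ => Finset.range N := by
    refine ⟨(T.sup fun k => ∑ i, k i) + 1, fun k hk => ?_⟩
    rw [Fintype.mem_piFinset]
    intro i
    rw [Finset.mem_range, Nat.lt_succ_iff]
    exact (Finset.single_le_sum (f := k) (fun _ _ => Nat.zero_le _) (Finset.mem_univ i)).trans
      (Finset.le_sup (f := fun k : ι → ℕ => ∑ i, k i) hk)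
  have h0 : ∀ k : ι → ℕ, 0 ≤ ∏ i, y i ^ k i / ((k i).factorial : ℝ) := fun k =>
    Finset.prod_nonneg fun i _ => div_nonneg (pow_nonneg (hy i) _) (Nat.cast_nonneg _)
  refine (Finset.sum_le_sum_of_subset_of_nonneg hN fun k _ _ => h0 k).trans ?_
  rw [← Finset.prod_univ_sum (fun _ => Finset.range N)
    (fun i j => y i ^ j / (j.factorial : ℝ)), Real.exp_sum]
  exact Finset.prod_le_prod
    (fun i _ => Finset.sum_nonneg fun j _ => div_nonneg (pow_nonneg (hy i) _) (Nat.cast_nonneg _))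
    fun i _ => Real.sum_le_exp_of_nonneg (hy i) N

/-- Powers of `θ` measure the order, while the `y i` are collected into an exponential. The lemma
serves both for `θ ≤ 1` with tuples of weight at least `m` and for `θ ≥ 1` with tuples of weight at
most `m`. -/
theorem norm_sum_prod_pow_div_factorial_le [DecidableEq ι] {x : ι → ℂ} {y : ι → ℝ} {θ : ℝ}
    (hθ : 0 ≤ θ) {w : ι → ℕ} (hy : ∀ i, 0 ≤ y i) (hxy : ∀ i, ‖x i‖ ≤ θ ^ w i * y i) {m : ℕ}
    (T : Finset (ι → ℕ)) (hT : ∀ k ∈ T, θ ^ (∑ i, k i * w i) ≤ θ ^ m) :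
    ‖∑ k ∈ T, ∏ i, x i ^ k i / ((k i).factorial : ℂ)‖ ≤ θ ^ m * Real.exp (∑ i, y i) := by
  calc ‖∑ k ∈ T, ∏ i, x i ^ k i / ((k i).factorial : ℂ)‖
      ≤ ∑ k ∈ T, θ ^ m * ∏ i, y i ^ k i / ((k i).factorial : ℝ) := by
        refine norm_sum_le_of_le _ fun k hk => (norm_prod_pow_div_factorial_le hθ hxy k).trans ?_
        refine mul_le_mul_of_nonneg_right (hT k hk) (Finset.prod_nonneg fun i _ => ?_)
        exact div_nonneg (pow_nonneg (hy i) _) (Nat.cast_nonneg _)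
    _ ≤ θ ^ m * Real.exp (∑ i, y i) := by
        rw [← Finset.mul_sum]
        exact mul_le_mul_of_nonneg_left (sum_prod_pow_div_factorial_le_exp hy T) (pow_nonneg hθ m)

/-- The exponential series of a finite sum, truncated to the terms of low weight. -/
theorem norm_exp_sum_sub_sum_prod_le [DecidableEq ι] {x : ι → ℂ} {y : ι → ℝ} {θ : ℝ}
    (hθ : 0 ≤ θ) (hθ1 : θ ≤ 1) {w : ι → ℕ} (hy : ∀ i, 0 ≤ y i)
    (hxy : ∀ i, ‖x i‖ ≤ θ ^ w i * y i) {m : ℕ} (T : Finset (ι → ℕ))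
    (hT : ∀ k, k ∉ T → m ≤ ∑ i, k i * w i) :
    ‖Complex.exp (∑ i, x i) - ∑ k ∈ T, ∏ i, x i ^ k i / ((k i).factorial : ℂ)‖ ≤
      θ ^ m * Real.exp (∑ i, y i) := by
  have hlim : Filter.Tendsto (fun N : ℕ => ∑ k ∈ Fintype.piFinset fun _ => Finset.range N,
      ∏ i, x i ^ k i / ((k i).factorial : ℂ)) Filter.atTop (nhds (Complex.exp (∑ i, x i))) := by
    simp_rw [← Finset.prod_univ_sum (fun _ => Finset.range _)
      (fun i j => x i ^ j / (j.factorial : ℂ)), Complex.exp_sum]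
    refine tendsto_finsetProd _ fun i _ => ?_
    rw [Complex.exp_eq_exp_ℂ]
    exact (NormedSpace.expSeries_div_hasSum_exp (x i)).tendsto_sum_nat
  -- Once the box contains `T`, the difference is a finite sum over tuples outside `T`.
  refine le_of_tendsto (hlim.sub_const _).norm ?_
  filter_upwards [Filter.eventually_ge_atTop ((T.sup fun k => ∑ i, k i) + 1)] with N hN
  have hTN : T ⊆ Fintype.piFinset fun _ => Finset.range N := by
    intro k hk
    rw [Fintype.mem_piFinset]
    intro i
    rw [Finset.mem_range]
    refine lt_of_lt_of_le (Nat.lt_succ_of_le ?_) hN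
    exact (Finset.single_le_sum (f := k) (fun _ _ => Nat.zero_le _) (Finset.mem_univ i)).trans
      (Finset.le_sup (f := fun k : ι → ℕ => ∑ i, k i) hk)
  rw [← Finset.sum_sdiff hTN, add_sub_cancel_right]
  refine norm_sum_prod_pow_div_factorial_le hθ hy hxy _ fun k hk => ?_
  exact pow_le_pow_of_le_one hθ hθ1 (hT k (Finset.mem_sdiff.1 hk).2)

end ExpTruncation

/-! ### The Edgeworth polynomial. -/

/-- The polynomial `1 + ∑_r y^r ∑_k ∏_j a_j^{k_j} / k_j!` over Edgeworth tuples `k`. -/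
noncomputable def edgeworthPoly (a : ℕ → ℝ) (d : ℕ) (y : ℂ) : ℂ :=
  1 + ∑ r ∈ Finset.Icc 3 (6 * d), y ^ r * ((∑ k ∈ edgeworthTuples d r,
    ∏ j : Finset.Icc 3 (2 * d + 1), a j ^ k j / ((k j).factorial : ℝ) : ℝ) : ℂ)

open Classical in
/-- All tuples of weight at most `d`. -/
noncomputable def allEdgeworthTuples (d : ℕ) : Finset (Finset.Icc 3 (2 * d + 1) → ℕ) :=
  (Finset.range (6 * d + 1)).biUnion (edgeworthTuples d)

/-- Doubling the weight makes it integral; natural subtraction is harmless because `j ≥ 3`. -/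
theorem isEdgeworthTuple_iff {d r : ℕ} {k : Finset.Icc 3 (2 * d + 1) → ℕ} :
    IsEdgeworthTuple d r k ↔ ∑ j, k j * (j : ℕ) = r ∧ ∑ j, k j * ((j : ℕ) - 2) ≤ 2 * d := by
  have h : ∑ j, (k j : ℚ) * ((((j : ℕ) : ℚ) - 2) / 2) =
      ((∑ j, k j * ((j : ℕ) - 2) : ℕ) : ℚ) / 2 := by
    push_cast
    rw [Finset.sum_div]
    refine Finset.sum_congr rfl fun j _ => ?_
    have h3 := (Finset.mem_Icc.1 j.2).1
    rw [Nat.cast_sub (by omega)]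
    push_cast; ring
  rw [IsEdgeworthTuple, h, div_le_iff₀ two_pos]
  refine and_congr_right fun _ => ?_
  rw [mul_comm (d : ℚ)]
  exact_mod_cast Iff.rfl

theorem mem_allEdgeworthTuples {d : ℕ} {k : Finset.Icc 3 (2 * d + 1) → ℕ} :
    k ∈ allEdgeworthTuples d ↔ ∑ j, k j * ((j : ℕ) - 2) ≤ 2 * d := by
  simp only [allEdgeworthTuples, Finset.mem_biUnion, mem_edgeworthTuples, isEdgeworthTuple_iff]
  refine ⟨fun ⟨_, _, _, h⟩ => h, fun h => ⟨_, ?_, rfl, h⟩⟩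
  by_contra hr
  rw [Finset.mem_range] at hr
  have : k ∈ edgeworthTuples d (∑ j, k j * (j : ℕ)) :=
    mem_edgeworthTuples.2 (isEdgeworthTuple_iff.2 ⟨rfl, h⟩)
  rw [edgeworthTuples_eq_empty (by omega)] at this
  simp at this

/-- Ungrouping by `r` exhibits a truncated exponential series. The leading `1` is the zero tuple,
and `r = 1, 2` contribute nothing since every `j` is at least `3`. -/
theorem edgeworthPoly_eq_sum (a : ℕ → ℝ) (d : ℕ) (y : ℂ) :
    edgeworthPoly a d y = ∑ k ∈ allEdgeworthTuples d, ∏ j : Finset.Icc 3 (2 * d + 1),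
      ((a j : ℂ) * y ^ (j : ℕ)) ^ k j / ((k j).factorial : ℂ) := by
  classical
  rw [allEdgeworthTuples, Finset.sum_biUnion]
  · have hr : ∀ r, ∑ k ∈ edgeworthTuples d r, ∏ j : Finset.Icc 3 (2 * d + 1),
        ((a j : ℂ) * y ^ (j : ℕ)) ^ k j / ((k j).factorial : ℂ) =
        y ^ r * ((∑ k ∈ edgeworthTuples d r,
          ∏ j : Finset.Icc 3 (2 * d + 1), a j ^ k j / ((k j).factorial : ℝ) : ℝ) : ℂ) := by
      intro r
      push_cast
      rw [Finset.mul_sum]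
      refine Finset.sum_congr rfl fun k hk => ?_
      rw [← (mem_edgeworthTuples.1 hk).1, ← Finset.prod_pow_eq_pow_sum, ← Finset.prod_mul_distrib]
      refine Finset.prod_congr rfl fun j _ => ?_
      rw [mul_pow, ← pow_mul, mul_comm (k j)]
      ring
    simp_rw [hr]
    have hsmall : ∀ r, r ≠ 0 → r < 3 → edgeworthTuples d r = ∅ := by
      intro r h0 h3
      rw [Finset.eq_empty_iff_forall_notMem]
      intro k hk
      have h1 := (mem_edgeworthTuples.1 hk).1
      have hk0 : ∀ j, k j = 0 := by
        intro j
        by_contra hj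
        have h4 : k j * (j : ℕ) ≤ r := h1 ▸ Finset.single_le_sum
          (f := fun j : Finset.Icc 3 (2 * d + 1) => k j * (j : ℕ))
          (fun _ _ => Nat.zero_le _) (Finset.mem_univ j)
        have h5 := (Finset.mem_Icc.1 j.2).1
        nlinarith [Nat.pos_of_ne_zero hj]
      simp [hk0] at h1
      exact h0 h1.symm
    have hzero : edgeworthTuples d 0 = {0} := by
      ext k
      rw [mem_edgeworthTuples, isEdgeworthTuple_iff, Finset.mem_singleton]
      constructor
      · rintro ⟨h, -⟩
        ext j
        rw [Finset.sum_eq_zero_iff] at h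
        have := h j (Finset.mem_univ j)
        have h5 := (Finset.mem_Icc.1 j.2).1
        rcases Nat.mul_eq_zero.1 this with h | h
        · simpa using h
        · omega
      · rintro rfl; simp
    have hsub : insert 0 (Finset.Icc 3 (6 * d)) ⊆ Finset.range (6 * d + 1) := by
      intro r hr
      simp only [Finset.mem_insert, Finset.mem_Icc] at hr
      rw [Finset.mem_range]
      omega
    rw [edgeworthPoly, ← Finset.sum_subset hsub, Finset.sum_insert (by simp), hzero]
    · simp
    · intro r hr hr'
      simp only [Finset.mem_insert, Finset.mem_Icc, Finset.mem_range] at hr hr'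
      rw [hsmall r (by omega) (by omega)]
      simp
  · intro r _ r' _ hne
    rw [Function.onFun, Finset.disjoint_left]
    intro k hk hk'
    exact hne ((mem_edgeworthTuples.1 hk).1.symm.trans (mem_edgeworthTuples.1 hk').1)

theorem sum_Icc_geometric_le {q : ℝ} (hq : 0 ≤ q) (hq2 : q ≤ 1 / 2) (m : ℕ) :
    ∑ j : Finset.Icc 3 m, q ^ (j : ℕ) ≤ 2 * q ^ 3 := by
  rw [Finset.sum_coe_sort (Finset.Icc 3 m) (fun j => q ^ j)]
  calc ∑ j ∈ Finset.Icc 3 m, q ^ j ≤ ∑ j ∈ Finset.Ico 3 (m + 1), q ^ j := le_of_eq rfl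
    _ ≤ q ^ 3 / (1 - q) := geom_sum_Ico_le_of_lt_one hq (by linarith)
    _ ≤ 2 * q ^ 3 := by
      rw [div_le_iff₀ (by linarith)]
      nlinarith [pow_nonneg hq 3]

/-- The split `|t|^j = |t|^{j-2} t²`: the first factor gives the order, and `B t²` is left for the
Gaussian to absorb. -/
theorem norm_edgeworth_term_le {a : ℕ → ℝ} {B r₁ t₀ : ℝ} (ht₀ : 0 < t₀) (hr₁ : 0 < r₁)
    {j : ℕ} (hj : 2 ≤ j) (ha : |a j| ≤ B / r₁ ^ j) (t : ℝ) :
    ‖(a j : ℂ) * (t * Complex.I) ^ j‖ ≤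
      (|t| / t₀) ^ (j - 2) * (B * (|t| / t₀) ^ 2 * (t₀ / r₁) ^ j) := by
  have h1 : ‖(a j : ℂ) * (t * Complex.I) ^ j‖ = |a j| * |t| ^ j := by simp
  have h2 : (|t| / t₀) ^ (j - 2) * (B * (|t| / t₀) ^ 2 * (t₀ / r₁) ^ j) = B / r₁ ^ j * |t| ^ j := by
    have : (|t| / t₀) ^ j = (|t| / t₀) ^ (j - 2) * (|t| / t₀) ^ 2 := by
      rw [← pow_add]; congr 1; omega
    calc _ = B * ((|t| / t₀) ^ (j - 2) * (|t| / t₀) ^ 2) * (t₀ / r₁) ^ j := by ring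
      _ = _ := by
        rw [← this, div_pow, div_pow]
        field_simp
  rw [h1, h2]
  exact mul_le_mul_of_nonneg_right ha (by positivity)

/-! ### Pointwise approximation of the characteristic function. -/

section Pointwise

variable {a : ℕ → ℝ} {B c r₁ t₀ : ℝ}

/-- `hc` makes the collected `y`'s at most a quarter of the Gaussian exponent `ct²/2`. In the
application `B` and `c` are both linear in `n`, so `t₀` can be chosen independently of `n`. -/
theorem sum_edgeworth_weight_le (hB : 0 ≤ B) (ht₀ : 0 < t₀) (hr₁ : 0 < r₁) (hq : t₀ / r₁ ≤ 1 / 2)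
    (hc : 16 * B * t₀ ≤ c * r₁ ^ 3) (m : ℕ) (t : ℝ) :
    ∑ j : Finset.Icc 3 m, B * (|t| / t₀) ^ 2 * (t₀ / r₁) ^ (j : ℕ) ≤ c * t ^ 2 / 8 := by
  rw [← Finset.mul_sum]
  calc _ ≤ B * (|t| / t₀) ^ 2 * (2 * (t₀ / r₁) ^ 3) := by
        gcongr
        exact sum_Icc_geometric_le (by positivity) hq m
    _ = 16 * B * t₀ * (t ^ 2 / (8 * r₁ ^ 3)) := by
        rw [div_pow, div_pow, sq_abs]; field_simp; ring
    _ ≤ c * r₁ ^ 3 * (t ^ 2 / (8 * r₁ ^ 3)) := by gcongr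
    _ = c * t ^ 2 / 8 := by field_simp

theorem norm_edgeworthPoly_le (hB : 0 ≤ B) (ht₀ : 0 < t₀) (hr₁ : 0 < r₁) (hq : t₀ / r₁ ≤ 1 / 2)
    (hc : 16 * B * t₀ ≤ c * r₁ ^ 3) (ha : ∀ j, |a j| ≤ B / r₁ ^ j) (d : ℕ) {t : ℝ}
    (ht : t₀ ≤ |t|) :
    ‖edgeworthPoly a d (t * Complex.I)‖ ≤
      (|t| / t₀) ^ (2 * d + 1) * Real.exp (c * t ^ 2 / 8) := by
  rw [edgeworthPoly_eq_sum]
  have hθ : 1 ≤ |t| / t₀ := (one_le_div ht₀).2 ht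
  refine (norm_sum_prod_pow_div_factorial_le (by positivity)
    (y := fun j : Finset.Icc 3 (2 * d + 1) => B * (|t| / t₀) ^ 2 * (t₀ / r₁) ^ (j : ℕ))
    (w := fun j => (j : ℕ) - 2) (fun j => by positivity)
    (fun j => norm_edgeworth_term_le ht₀ hr₁ (by have := (Finset.mem_Icc.1 j.2).1; omega) (ha j) t)
    (m := 2 * d + 1) _ fun k hk => ?_).trans ?_
  · exact pow_le_pow_right₀ hθ ((mem_allEdgeworthTuples.1 hk).trans (by omega))
  · gcongr
    exact sum_edgeworth_weight_le hB ht₀ hr₁ hq hc _ t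

theorem norm_exp_sub_edgeworthPoly_le (hB : 0 ≤ B) (ht₀ : 0 < t₀) (hr₁ : 0 < r₁)
    (hq : t₀ / r₁ ≤ 1 / 2) (hc : 16 * B * t₀ ≤ c * r₁ ^ 3) (ha : ∀ j, |a j| ≤ B / r₁ ^ j) (d : ℕ)
    {t : ℝ} (ht : |t| ≤ t₀) :
    ‖Complex.exp (∑ j ∈ Finset.Icc 3 (2 * d + 1), (a j : ℂ) * (t * Complex.I) ^ j) -
        edgeworthPoly a d (t * Complex.I)‖ ≤
      (|t| / t₀) ^ (2 * d + 1) * Real.exp (c * t ^ 2 / 8) := by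
  rw [edgeworthPoly_eq_sum, ← Finset.sum_coe_sort (Finset.Icc 3 (2 * d + 1))]
  have hθ : |t| / t₀ ≤ 1 := (div_le_one ht₀).2 ht
  refine (norm_exp_sum_sub_sum_prod_le (by positivity) hθ
    (y := fun j : Finset.Icc 3 (2 * d + 1) => B * (|t| / t₀) ^ 2 * (t₀ / r₁) ^ (j : ℕ))
    (w := fun j => (j : ℕ) - 2) (fun j => by positivity)
    (fun j => norm_edgeworth_term_le ht₀ hr₁ (by have := (Finset.mem_Icc.1 j.2).1; omega) (ha j) t)
    (m := 2 * d + 1) _ fun k hk => ?_).trans ?_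
  · rw [mem_allEdgeworthTuples] at hk
    omega
  · gcongr
    exact sum_edgeworth_weight_le hB ht₀ hr₁ hq hc _ t

theorem norm_sum_edgeworth_terms_le (hB : 0 ≤ B) (ht₀ : 0 < t₀) (hr₁ : 0 < r₁)
    (hq : t₀ / r₁ ≤ 1 / 2) (hc : 16 * B * t₀ ≤ c * r₁ ^ 3) (ha : ∀ j, |a j| ≤ B / r₁ ^ j) (m : ℕ)
    {t : ℝ} (ht : |t| ≤ t₀) :
    ‖∑ j ∈ Finset.Icc 3 m, (a j : ℂ) * (t * Complex.I) ^ j‖ ≤ c * t ^ 2 / 8 := by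
  rw [← Finset.sum_coe_sort (Finset.Icc 3 m)]
  refine (norm_sum_le_of_le _ fun j _ => ?_).trans (sum_edgeworth_weight_le hB ht₀ hr₁ hq hc m t)
  have h3 := (Finset.mem_Icc.1 j.2).1
  refine (norm_edgeworth_term_le ht₀ hr₁ (by omega) (ha j) t).trans ?_
  have hθ : |t| / t₀ ≤ 1 := (div_le_one ht₀).2 ht
  exact mul_le_of_le_one_left (by positivity) (pow_le_one₀ (by positivity) hθ)

theorem norm_sub_sum_range_le {S z : ℂ} (hr₁ : 0 < r₁)
    (hS : HasSum (fun j : ℕ => (a j : ℂ) * z ^ j) S)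
    (ha : ∀ j, |a j| ≤ B / r₁ ^ j) (hz : ‖z‖ / r₁ ≤ 1 / 2) (m : ℕ) :
    ‖S - ∑ j ∈ Finset.range m, (a j : ℂ) * z ^ j‖ ≤ 2 * B * (‖z‖ / r₁) ^ m := by
  have h1 : HasSum (fun j : ℕ => (a (j + m) : ℂ) * z ^ (j + m))
      (S - ∑ j ∈ Finset.range m, (a j : ℂ) * z ^ j) := (hasSum_nat_add_iff' m).2 hS
  have hq : 0 ≤ ‖z‖ / r₁ := by positivity
  have h2 := (hasSum_geometric_of_lt_one hq (by linarith)).mul_left (B * (‖z‖ / r₁) ^ m)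
  have hB : 0 ≤ B := by simpa using (abs_nonneg _).trans (ha 0)
  rw [← h1.tsum_eq]
  refine (tsum_of_norm_bounded h2 fun j => ?_).trans ?_
  · rw [norm_mul, norm_pow, Complex.norm_real, Real.norm_eq_abs]
    calc |a (j + m)| * ‖z‖ ^ (j + m) ≤ B / r₁ ^ (j + m) * ‖z‖ ^ (j + m) := by
          gcongr; exact ha _
      _ = B * (‖z‖ / r₁) ^ m * (‖z‖ / r₁) ^ j := by
          rw [mul_assoc, ← pow_add, add_comm m, div_pow]; ring
  · rw [mul_comm 2 B, mul_assoc, mul_assoc]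
    have : (1 - ‖z‖ / r₁)⁻¹ ≤ 2 := by
      rw [inv_le_comm₀ (by linarith) two_pos]; linarith
    rw [mul_comm 2]
    gcongr

theorem Complex.norm_exp_sub_exp_le (x y : ℂ) :
    ‖Complex.exp x - Complex.exp y‖ ≤ ‖x - y‖ * Real.exp (‖x - y‖ + ‖y‖) := by
  have h1 : Complex.exp x - Complex.exp y = (Complex.exp (x - y) - 1) * Complex.exp y := by
    rw [sub_mul, ← Complex.exp_add, sub_add_cancel, one_mul]
  have h2 := Complex.norm_exp_sub_sum_le_norm_mul_exp (x - y) 1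
  simp only [Finset.sum_range_one, pow_zero, Nat.factorial_zero, Nat.cast_one, div_one,
    pow_one] at h2
  rw [h1, norm_mul, Real.exp_add, ← mul_assoc]
  gcongr
  exact Complex.norm_exp_le_exp_norm y

/-- The characteristic function of a centred variable near the origin, against its Edgeworth
approximation. -/
theorem norm_cexp_sub_gaussian_mul_edgeworthPoly_le {S : ℂ} (hB : 0 ≤ B) (ht₀ : 0 < t₀)
    (hr₁ : 0 < r₁) (hq : t₀ / r₁ ≤ 1 / 2) (hc : 16 * B * t₀ ≤ c * r₁ ^ 3)
    (ha : ∀ j, |a j| ≤ B / r₁ ^ j) (ha0 : a 0 = 0) (hac : c ≤ 2 * a 2) (d : ℕ) {t : ℝ}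
    (ht : |t| ≤ t₀) (hS : HasSum (fun j : ℕ => (a j : ℂ) * (t * Complex.I) ^ j) S) :
    ‖Complex.exp (S - a 1 * (t * Complex.I)) -
        Complex.exp (-(a 2 * t ^ 2 : ℝ)) * edgeworthPoly a d (t * Complex.I)‖ ≤
      ((|t| / t₀) ^ (2 * d + 1) + 2 * B * (|t| / r₁) ^ (2 * d + 2)) *
        Real.exp (-(c * t ^ 2 / 4)) := by
  set z : ℂ := t * Complex.I with hz
  have hzn : ‖z‖ = |t| := by simp [hz]
  set W : ℂ := ∑ j ∈ Finset.Icc 3 (2 * d + 1), (a j : ℂ) * z ^ j with hW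
  set W' : ℂ := S - a 1 * z - a 2 * z ^ 2 with hW'
  have hq1 : |t| / r₁ ≤ 1 / 2 := le_trans (by gcongr) hq
  have hsplit : ∀ m, 3 ≤ m → ∑ j ∈ Finset.range m, (a j : ℂ) * z ^ j =
      a 1 * z + a 2 * z ^ 2 + ∑ j ∈ Finset.Ico 3 m, (a j : ℂ) * z ^ j := by
    intro m hm
    rw [← Finset.sum_range_add_sum_Ico _ hm]
    simp [Finset.sum_range_succ, ha0]
  -- The maximum with `3` matters for `d = 0`, where the terms up to `j = 2` have been split off
  -- although `2 * d + 2 = 2`.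
  have htail : ‖W' - W‖ ≤ 2 * B * (|t| / r₁) ^ max 3 (2 * d + 2) := by
    have h1 := norm_sub_sum_range_le hr₁ hS ha (by rw [hzn]; exact hq1) (max 3 (2 * d + 2))
    rw [hsplit _ (le_max_left _ _), hzn] at h1
    convert h1 using 2
    rw [hW', hW]
    have : Finset.Icc 3 (2 * d + 1) = Finset.Ico 3 (max 3 (2 * d + 2)) := by
      ext j; simp only [Finset.mem_Icc, Finset.mem_Ico]; omega
    rw [this]; ring
  have htail1 : ‖W' - W‖ ≤ 2 * B * (|t| / r₁) ^ (2 * d + 2) := htail.trans (by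
    gcongr 2 * B * ?_
    exact pow_le_pow_of_le_one (by positivity) (by linarith) (le_max_right _ _))
  -- The same tail is needed twice: `htail1` gives its order, and this cubic bound keeps the
  -- exponent below the Gaussian.
  have htail2 : ‖W' - W‖ ≤ c * t ^ 2 / 8 := htail.trans (by
    calc 2 * B * (|t| / r₁) ^ max 3 (2 * d + 2) ≤ 2 * B * (|t| / r₁) ^ 3 := by
          gcongr 2 * B * ?_
          exact pow_le_pow_of_le_one (by positivity) (by linarith) (le_max_left _ _)
      _ = 2 * B * |t| * (t ^ 2 / r₁ ^ 3) := by rw [← sq_abs t]; ring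
      _ ≤ 2 * B * t₀ * (t ^ 2 / r₁ ^ 3) := by gcongr
      _ = 16 * B * t₀ * (t ^ 2 / (8 * r₁ ^ 3)) := by field_simp; ring
      _ ≤ c * r₁ ^ 3 * (t ^ 2 / (8 * r₁ ^ 3)) := by gcongr
      _ = c * t ^ 2 / 8 := by field_simp)
  have hWn : ‖W‖ ≤ c * t ^ 2 / 8 := norm_sum_edgeworth_terms_le hB ht₀ hr₁ hq hc ha _ ht
  have hexp : Complex.exp (S - a 1 * z) = Complex.exp (-(a 2 * t ^ 2 : ℝ)) * Complex.exp W' := by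
    rw [← Complex.exp_add, hW']
    congr 1
    rw [hz, mul_pow, Complex.I_sq]
    push_cast; ring
  have hmain : ‖Complex.exp W' - edgeworthPoly a d z‖ ≤
      ((|t| / t₀) ^ (2 * d + 1) + 2 * B * (|t| / r₁) ^ (2 * d + 2)) *
        Real.exp (c * t ^ 2 / 4) := by
    calc ‖Complex.exp W' - edgeworthPoly a d z‖
        ≤ ‖Complex.exp W' - Complex.exp W‖ + ‖Complex.exp W - edgeworthPoly a d z‖ :=
          norm_sub_le_norm_sub_add_norm_sub _ _ _
      _ ≤ 2 * B * (|t| / r₁) ^ (2 * d + 2) * Real.exp (c * t ^ 2 / 4) +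
          (|t| / t₀) ^ (2 * d + 1) * Real.exp (c * t ^ 2 / 4) := by
          have hcpos : 0 ≤ c * t ^ 2 / 8 := (norm_nonneg _).trans hWn
          refine add_le_add ((Complex.norm_exp_sub_exp_le _ _).trans ?_)
            ((norm_exp_sub_edgeworthPoly_le hB ht₀ hr₁ hq hc ha d ht).trans ?_)
          · gcongr
            linarith
          · exact mul_le_mul_of_nonneg_left (Real.exp_le_exp.2 (by linarith)) (by positivity)
      _ = _ := by ring
  -- The Gaussian contributes `e^{-ct²/2}`, of which the errors use up `e^{ct²/4}`.
  rw [hexp, ← mul_sub, norm_mul, Complex.norm_exp, ← Complex.ofReal_neg, Complex.ofReal_re]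
  calc Real.exp (-(a 2 * t ^ 2)) * ‖Complex.exp W' - edgeworthPoly a d z‖
      ≤ Real.exp (-(c * t ^ 2 / 2)) * (((|t| / t₀) ^ (2 * d + 1) +
          2 * B * (|t| / r₁) ^ (2 * d + 2)) * Real.exp (c * t ^ 2 / 4)) := by
        gcongr
        nlinarith [sq_nonneg t]
    _ = _ := by
        rw [mul_left_comm, ← Real.exp_add]
        ring_nf

end Pointwise

/-! ### Fourier integrals of Gaussians and Hermite polynomials. -/

theorem iteratedDeriv_ofReal_comp {h : ℝ → ℝ} (hh : ContDiff ℝ ⊤ h) (r : ℕ) :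
    iteratedDeriv r (fun w => (h w : ℂ)) = fun w => ((iteratedDeriv r h w : ℝ) : ℂ) := by
  induction r with
  | zero => simp
  | succ r ih =>
    ext w
    have hd : DifferentiableAt ℝ (iteratedDeriv r h) w :=
      (hh.differentiable_iteratedDeriv r (by exact_mod_cast WithTop.coe_lt_top _)) w
    rw [iteratedDeriv_succ, ih, hd.hasDerivAt.ofReal_comp.deriv, iteratedDeriv_succ]

theorem integrable_pow_mul_exp_neg_mul_sq {b : ℝ} (hb : 0 < b) (r : ℕ) :
    Integrable fun x : ℝ => x ^ r * Real.exp (-b * x ^ 2) := by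
  have := integrable_rpow_mul_exp_neg_mul_sq hb (s := r) (by linarith [(Nat.cast_nonneg r : (0:ℝ) ≤ r)])
  simpa only [Real.rpow_natCast] using this

open FourierTransform in
-- Multiplication by `x^r` becomes an `r`-fold derivative of the Fourier transform, and derivatives
-- of the Gaussian are Hermite polynomials times the Gaussian; the signs `(-1)^r` cancel.
theorem integral_pow_mul_gaussian_mul_cexp (r : ℕ) (y : ℝ) :
    ∫ x : ℝ, (x * Complex.I) ^ r * Complex.exp (-(x ^ 2 / 2 : ℝ)) *
        Complex.exp (-(x * y * Complex.I)) =
      (√(2 * Real.pi) * Polynomial.aeval y (Polynomial.hermite r) *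
        Real.exp (-(y ^ 2 / 2)) : ℝ) := by
  have hpi := Real.pi_pos
  -- `e^{-x²/2}` in the normalisation `e^{-πbx²}`; the transform is then evaluated at `y/(2π)`.
  set f : ℝ → ℂ := fun x => Complex.exp (-Real.pi * (1 / (2 * Real.pi)) * x ^ 2) with hf
  have hfx : ∀ x, f x = Complex.exp (-(x ^ 2 / 2 : ℝ)) := by
    intro x
    rw [hf]
    push_cast
    field_simp
  have hfr : ∀ x, f x = (Real.exp (-(1 / 2) * x ^ 2) : ℂ) := by
    intro x
    rw [hfx]
    push_cast
    congr 1
    ring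
  have hF : 𝓕 f = fun w => ((√(2 * Real.pi) * Real.exp (-((2 * Real.pi * w) ^ 2 / 2)) : ℝ) : ℂ) := by
    rw [hf, fourier_gaussian_pi (by
      rw [show (1 / (2 * Real.pi) : ℂ) = ((1 / (2 * Real.pi) : ℝ) : ℂ) by push_cast; ring,
        Complex.ofReal_re]
      positivity)]
    ext w
    push_cast
    congr 1
    · rw [one_div, one_div, Real.sqrt_eq_rpow, Complex.ofReal_cpow (by positivity)]
      rw [show (2 * (Real.pi : ℂ)) = ((2 * Real.pi : ℝ) : ℂ) by push_cast; ring,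
        Complex.inv_cpow, inv_inv]
      · push_cast; ring_nf
      · rw [Complex.arg_ofReal_of_nonneg (by positivity)]
        exact hpi.ne
    · congr 1
      field_simp
  have hG : ContDiff ℝ ⊤ fun y : ℝ => Real.exp (-(y ^ 2 / 2)) := by fun_prop
  have hint : ∀ n : ℕ, (n : ℕ∞) ≤ ⊤ → Integrable fun x : ℝ => x ^ n • f x := by
    intro n _
    have := (integrable_pow_mul_exp_neg_mul_sq (b := 1 / 2) (by norm_num) n).ofReal (𝕜 := ℂ)
    refine this.congr (Filter.Eventually.of_forall fun x => ?_)
    simp only [hfr]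
    simp
  have key := congrFun (Real.iteratedDeriv_fourier (n := r) hint le_top) (y / (2 * Real.pi))
  rw [hF, iteratedDeriv_ofReal_comp (by fun_prop)] at key
  have hder : iteratedDeriv r (fun w => √(2 * Real.pi) *
      Real.exp (-((2 * Real.pi * w) ^ 2 / 2))) (y / (2 * Real.pi)) =
      √(2 * Real.pi) * ((2 * Real.pi) ^ r * ((-1) ^ r * Polynomial.aeval y (Polynomial.hermite r) *
        Real.exp (-(y ^ 2 / 2)))) := by
    rw [iteratedDeriv_const_mul_field,
      iteratedDeriv_comp_const_mul (f := fun y : ℝ => Real.exp (-(y ^ 2 / 2)))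
        (hG.of_le le_top), iteratedDeriv_eq_iterate]
    beta_reduce
    rw [Polynomial.deriv_gaussian_eq_hermite_mul_gaussian, mul_div_cancel₀ _ (by positivity)]
  beta_reduce at key
  rw [hder, Real.fourier_eq'] at key
  have hc : ((-(2 * Real.pi)) ^ r : ℂ) ≠ 0 := pow_ne_zero _ (by simp [hpi.ne'])
  apply mul_left_cancel₀ hc
  rw [← integral_const_mul]
  trans ((√(2 * Real.pi) * ((2 * Real.pi) ^ r * ((-1) ^ r *
      Polynomial.aeval y (Polynomial.hermite r) * Real.exp (-(y ^ 2 / 2)))) : ℝ) : ℂ)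
  · rw [key]
    refine integral_congr_ae (Filter.Eventually.of_forall fun x => ?_)
    simp only [hfx, smul_eq_mul]
    have e1 : (((-2 * Real.pi * inner ℝ x (y / (2 * Real.pi)) : ℝ) : ℂ) * Complex.I) =
        -(x * y * Complex.I) := by
      have : (-2 * Real.pi * inner ℝ x (y / (2 * Real.pi)) : ℝ) = -(x * y) := by
        rw [RCLike.inner_apply]
        simp only [conj_trivial]
        field_simp
      rw [this]
      push_cast; ring
    have e2 : (-2 * (Real.pi : ℂ) * Complex.I * x) ^ r =
        (-(2 * (Real.pi : ℂ))) ^ r * (x * Complex.I) ^ r := by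
      rw [← mul_pow]; congr 1; ring
    rw [e1, e2]
    ring
  · push_cast
    rw [neg_pow (2 * (Real.pi : ℂ))]
    generalize (-1 : ℂ) ^ r = e
    ring

theorem integral_gaussian_mul_pow_mul_cexp {s : ℝ} (hs : 0 < s) (r : ℕ) (l : ℝ) :
    ∫ t : ℝ, Complex.exp (-(s ^ 2 / 2 * t ^ 2 : ℝ)) * (t * Complex.I) ^ r *
        Complex.exp (-(t * l * Complex.I)) =
      (2 * Real.pi * gaussianDensity s l * (Polynomial.aeval (l / s) (Polynomial.hermite r)
        / s ^ r) : ℝ) := by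
  have h := integral_pow_mul_gaussian_mul_cexp r (l / s)
  have h2 := Measure.integral_comp_mul_left (fun x : ℝ => (x * Complex.I) ^ r *
    Complex.exp (-(x ^ 2 / 2 : ℝ)) * Complex.exp (-(x * (l / s : ℝ) * Complex.I))) s
  rw [h] at h2
  have hs' : (s : ℂ) ≠ 0 := by exact_mod_cast hs.ne'
  have h3 : ∀ t : ℝ, Complex.exp (-(s ^ 2 / 2 * t ^ 2 : ℝ)) * (t * Complex.I) ^ r *
        Complex.exp (-(t * l * Complex.I)) = ((s : ℂ) ^ r)⁻¹ * (((s * t : ℝ) * Complex.I) ^ r *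
    Complex.exp (-((s * t) ^ 2 / 2 : ℝ)) * Complex.exp (-((s * t : ℝ) * (l / s : ℝ) * Complex.I))) := by
    intro t
    have e1 : (-((s * t : ℝ) * (l / s : ℝ) * Complex.I)) = (-(t * l * Complex.I)) := by
      push_cast; field_simp
    have e2 : (s * t) ^ 2 / 2 = s ^ 2 / 2 * t ^ 2 := by ring
    rw [e1, e2]
    push_cast
    have e3 : ((s : ℂ) * t * Complex.I) ^ r = s ^ r * (t * Complex.I) ^ r := by
      rw [← mul_pow, mul_assoc]
    rw [e3]
    field_simp
  simp_rw [h3]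
  rw [integral_const_mul, h2, gaussianDensity, abs_of_pos (inv_pos.2 hs), Complex.real_smul]
  norm_cast
  have e3 : (l / s) ^ 2 / 2 = l ^ 2 / (2 * s ^ 2) := by field_simp
  have e4 : 2 * Real.pi = √(2 * Real.pi) * √(2 * Real.pi) :=
    (Real.mul_self_sqrt (by positivity)).symm
  have e5 : √(2 * Real.pi) ≠ 0 := by positivity
  rw [e3]
  nth_rewrite 2 [e4]
  field_simp

/-! ### Fourier inversion, low cumulants and variance on a finite space. -/

theorem integral_exp_int_mul_I (k : ℤ) :
    ∫ t in (-Real.pi)..Real.pi, Complex.exp (t * k * Complex.I) =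
      if k = 0 then (2 * Real.pi : ℂ) else 0 := by
  split_ifs with hk
  · simp [hk]
    ring
  · have hc : (k * Complex.I : ℂ) ≠ 0 := by simp [hk]
    have h1 : ∀ t : ℝ, Complex.exp (t * k * Complex.I) = Complex.exp (k * Complex.I * t) := by
      intro t; ring_nf
    simp_rw [h1]
    rw [integral_exp_mul_complex hc]
    have h2 : (k * Complex.I * (Real.pi : ℝ) : ℂ) =
        k * Complex.I * ((-Real.pi : ℝ) : ℂ) + k * (2 * Real.pi * Complex.I) := by
      push_cast; ring
    rw [h2, Complex.exp_add, Complex.exp_int_mul_two_pi_mul_I, mul_one, sub_self, zero_div]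

theorem cumulant_zero {Ω : Type u} [MeasurableSpace Ω] {μ : Measure Ω} [IsProbabilityMeasure μ]
    (X : Ω → ℝ) : cumulant X μ 0 = 0 := by
  simp [cumulant]

section FiniteSpace

variable {Ω : Type u} [Fintype Ω] [MeasurableSpace Ω] [MeasurableSingletonClass Ω]
  {μ : Measure Ω}

theorem complexMGF_eq_sum [IsFiniteMeasure μ] (X : Ω → ℝ) (z : ℂ) :
    complexMGF X μ z = ∑ ω, (μ.real {ω} : ℂ) * Complex.exp (z * X ω) := by
  rw [complexMGF, integral_fintype Integrable.of_finite]
  simp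

theorem continuous_complexMGF [IsFiniteMeasure μ] (X : Ω → ℝ) : Continuous (complexMGF X μ) := by
  simp_rw [funext (complexMGF_eq_sum (μ := μ) X)]
  fun_prop

/-- Fourier inversion for an integer-valued random variable. -/
theorem integral_complexMGF_mul_exp [IsFiniteMeasure μ] (N : Ω → ℕ) (m : ℕ) :
    ∫ t in (-Real.pi)..Real.pi, complexMGF (fun ω => (N ω : ℝ)) μ (t * Complex.I) *
      Complex.exp (-(t * m * Complex.I)) = 2 * Real.pi * μ.real {ω | N ω = m} := by
  classical
  have h1 : ∀ t : ℝ, complexMGF (fun ω => (N ω : ℝ)) μ (t * Complex.I) *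
      Complex.exp (-(t * m * Complex.I)) =
      ∑ ω, (μ.real {ω} : ℂ) * Complex.exp (t * ((N ω - m : ℤ) : ℂ) * Complex.I) := by
    intro t
    rw [complexMGF_eq_sum, Finset.sum_mul]
    refine Finset.sum_congr rfl fun ω _ => ?_
    rw [mul_assoc, ← Complex.exp_add]
    congr 2
    push_cast
    ring
  simp_rw [h1]
  rw [intervalIntegral.integral_finsetSum fun ω _ => by
    apply Continuous.intervalIntegrable; fun_prop]
  simp_rw [intervalIntegral.integral_const_mul, integral_exp_int_mul_I]
  have h2 : {ω | N ω = m} = ((Finset.univ.filter fun ω => N ω = m : Finset Ω) : Set Ω) := by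
    ext; simp
  rw [h2, ← sum_measureReal_singleton, Finset.sum_filter, Complex.ofReal_sum, Finset.mul_sum]
  refine Finset.sum_congr rfl fun ω _ => ?_
  simp only [sub_eq_zero, Nat.cast_inj]
  split_ifs <;> simp [mul_comm]

variable [IsProbabilityMeasure μ]

theorem integrableExpSet_eq_univ_of_finite (X : Ω → ℝ) : integrableExpSet X μ = Set.univ := by
  ext t
  simp [integrableExpSet]

theorem cumulant_one (X : Ω → ℝ) : cumulant X μ 1 = ∫ ω, X ω ∂μ := by
  rw [cumulant, iteratedDeriv_one, deriv_cgf_zero (by simp [integrableExpSet_eq_univ_of_finite])]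
  simp

theorem cumulant_two (X : Ω → ℝ) : cumulant X μ 2 = variance X μ := by
  have h : (0 : ℝ) ∈ interior (integrableExpSet X μ) := by
    simp [integrableExpSet_eq_univ_of_finite]
  rw [cumulant, iteratedDeriv_two_cgf_eq_integral h, deriv_cgf_zero h,
    variance_eq_integral (measurable_of_finite X).aemeasurable]
  simp

theorem norm_complexMGF_le_exp {N : Ω → ℕ} {n : ℕ} (hN : ∀ ω, N ω ≤ n) {r : ℝ} {z : ℂ}
    (hz : ‖z‖ ≤ r) : ‖complexMGF (fun ω => (N ω : ℝ)) μ z‖ ≤ Real.exp (n * r) := by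
  rw [complexMGF_eq_sum]
  calc _ ≤ ∑ ω, μ.real {ω} * Real.exp (n * r) := by
        refine norm_sum_le_of_le _ fun ω _ => ?_
        rw [norm_mul, Complex.norm_real, Real.norm_eq_abs, abs_of_nonneg measureReal_nonneg]
        gcongr
        refine (Complex.norm_exp_le_exp_norm _).trans (Real.exp_le_exp.2 ?_)
        rw [norm_mul, mul_comm]
        have : ‖((N ω : ℝ) : ℂ)‖ ≤ n := by simpa using hN ω
        gcongr
    _ = Real.exp (n * r) := by
        rw [← Finset.sum_mul, sum_measureReal_singleton]
        simp

/-- Gaussian decay of the characteristic function bounds the variance from below. -/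
theorem two_mul_le_variance (X : Ω → ℝ) {b : ℝ} (hb : 0 ≤ b)
    (h : ∀ t : ℝ, |t| ≤ Real.pi → ‖complexMGF X μ (t * Complex.I)‖ ≤ Real.exp (-(b * t ^ 2))) :
    2 * b ≤ variance X μ := by
  set E := ∫ ω, X ω ∂μ with hE
  set v := variance X μ with hv
  -- After centring, the modulus is at least the real part `E[cos(t(X - E))]`, and `cos x ≥ 1 -
  -- x²/2`.
  have hlow : ∀ t : ℝ, 1 - t ^ 2 * v / 2 ≤ ‖complexMGF X μ (t * Complex.I)‖ := by
    intro t
    have h1 : (∫ ω, Real.cos (t * (X ω - E)) ∂μ) ≤ ‖complexMGF X μ (t * Complex.I)‖ := by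
      have h2 : ‖complexMGF X μ (t * Complex.I)‖ =
          ‖∑ ω, (μ.real {ω} : ℂ) * Complex.exp ((t * (X ω - E) : ℝ) * Complex.I)‖ := by
        have h3 : ‖complexMGF X μ (t * Complex.I)‖ = ‖complexMGF X μ (t * Complex.I) *
            Complex.exp ((-(t * E) : ℝ) * Complex.I)‖ := by
          rw [norm_mul, Complex.norm_exp_ofReal_mul_I, mul_one]
        rw [h3, complexMGF_eq_sum, Finset.sum_mul]
        congr 1
        refine Finset.sum_congr rfl fun ω _ => ?_
        rw [mul_assoc, ← Complex.exp_add]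
        congr 2
        push_cast; ring
      rw [h2]
      refine le_trans (le_of_eq ?_) (Complex.re_le_norm _)
      rw [integral_fintype Integrable.of_finite, Complex.re_sum]
      refine Finset.sum_congr rfl fun ω _ => ?_
      rw [Complex.re_ofReal_mul, Complex.exp_ofReal_mul_I_re, smul_eq_mul]
    refine le_trans ?_ h1
    have h4 : 1 - t ^ 2 * v / 2 = ∫ ω, (1 - t ^ 2 / 2 * (X ω - E) ^ 2) ∂μ := by
      rw [integral_sub Integrable.of_finite Integrable.of_finite, integral_const_mul, hv,
        variance_eq_integral (measurable_of_finite X).aemeasurable]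
      simp
      ring
    rw [h4]
    refine integral_mono Integrable.of_finite Integrable.of_finite fun ω => ?_
    have := Real.one_sub_sq_div_two_le_cos (x := t * (X ω - E))
    rw [mul_pow] at this
    linarith
  -- Combine with `e^{-bt²} ≤ 1/(1 + bt²)` and divide by `t²`; then `t → 0`.
  have hineq : ∀ᶠ t : ℝ in nhdsWithin 0 (Set.Ioi 0), b - v / 2 ≤ b * v / 2 * t ^ 2 := by
    filter_upwards [Ioo_mem_nhdsGT Real.pi_pos] with t ht
    have h1 := (hlow t).trans (h t (by rw [abs_of_pos ht.1]; exact ht.2.le))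
    have hpos : 0 < b * t ^ 2 + 1 := by positivity
    rw [Real.exp_neg] at h1
    have h2 : (Real.exp (b * t ^ 2))⁻¹ ≤ (b * t ^ 2 + 1)⁻¹ :=
      inv_anti₀ hpos (Real.add_one_le_exp _)
    have h3 := h1.trans h2
    rw [inv_eq_one_div, le_div_iff₀ hpos] at h3
    have h4 : t ^ 2 * (b - v / 2) ≤ t ^ 2 * (b * v / 2 * t ^ 2) := by nlinarith
    exact le_of_mul_le_mul_left h4 (by have := ht.1; positivity)
  have hlim : Filter.Tendsto (fun t : ℝ => b * v / 2 * t ^ 2) (nhdsWithin 0 (Set.Ioi 0)) (nhds 0) := by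
    have : Continuous fun t : ℝ => b * v / 2 * t ^ 2 := by fun_prop
    have h0 := this.tendsto 0
    simp only [ne_eq, OfNat.ofNat_ne_zero, not_false_eq_true, zero_pow, mul_zero] at h0
    exact h0.mono_left nhdsWithin_le_nhds
  have := ge_of_tendsto hlim hineq
  linarith

end FiniteSpace

/-! ### Integrating the Edgeworth approximation and its error. -/

theorem integrable_gaussian_mul_pow_mul_cexp {s : ℝ} (hs : 0 < s) (r : ℕ) (l : ℝ) :
    Integrable fun t : ℝ => Complex.exp (-(s ^ 2 / 2 * t ^ 2 : ℝ)) * (t * Complex.I) ^ r *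
        Complex.exp (-(t * l * Complex.I)) := by
  refine (integrable_pow_mul_exp_neg_mul_sq (b := s ^ 2 / 2) (by positivity) r).mono
    (Continuous.aestronglyMeasurable (by fun_prop)) (Filter.Eventually.of_forall fun t => ?_)
  have h1 : -(t * l * Complex.I : ℂ) = ((-(t * l) : ℝ) : ℂ) * Complex.I := by push_cast; ring
  rw [h1, norm_mul, Complex.norm_exp_ofReal_mul_I, ← Complex.ofReal_neg, norm_mul, Complex.norm_exp,
    Complex.ofReal_re]
  simp [mul_comm]

theorem gaussian_mul_edgeworthPoly_eq (a : ℕ → ℝ) (d : ℕ) (s l t : ℝ) :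
    Complex.exp (-(s ^ 2 / 2 * t ^ 2 : ℝ)) * edgeworthPoly a d (t * Complex.I) *
        Complex.exp (-(t * l * Complex.I)) =
      Complex.exp (-(s ^ 2 / 2 * t ^ 2 : ℝ)) * (t * Complex.I) ^ 0 *
        Complex.exp (-(t * l * Complex.I)) +
      ∑ r ∈ Finset.Icc 3 (6 * d), ((∑ k ∈ edgeworthTuples d r,
        ∏ j : Finset.Icc 3 (2 * d + 1), a j ^ k j / ((k j).factorial : ℝ) : ℝ) : ℂ) *
        (Complex.exp (-(s ^ 2 / 2 * t ^ 2 : ℝ)) * (t * Complex.I) ^ r *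
        Complex.exp (-(t * l * Complex.I))) := by
  rw [edgeworthPoly, mul_add, add_mul, Finset.mul_sum, Finset.sum_mul, pow_zero]
  congr 1
  exact Finset.sum_congr rfl fun r _ => by ring

theorem integrable_gaussian_mul_edgeworthPoly (a : ℕ → ℝ) (d : ℕ) {s : ℝ} (hs : 0 < s) (l : ℝ) :
    Integrable fun t : ℝ => Complex.exp (-(s ^ 2 / 2 * t ^ 2 : ℝ)) *
      edgeworthPoly a d (t * Complex.I) * Complex.exp (-(t * l * Complex.I)) := by
  simp_rw [gaussian_mul_edgeworthPoly_eq]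
  exact (integrable_gaussian_mul_pow_mul_cexp hs 0 l).add (integrable_finsetSum _ fun r _ =>
    (integrable_gaussian_mul_pow_mul_cexp hs r l).const_mul _)

theorem integral_gaussian_mul_edgeworthPoly (a : ℕ → ℝ) (d : ℕ) {s : ℝ} (hs : 0 < s) (l : ℝ) :
    ∫ t : ℝ, Complex.exp (-(s ^ 2 / 2 * t ^ 2 : ℝ)) *
      edgeworthPoly a d (t * Complex.I) * Complex.exp (-(t * l * Complex.I)) =
    (2 * Real.pi * (gaussianDensity s l * (1 + ∑ r ∈ Finset.Icc 3 (6 * d),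
      Polynomial.aeval (l / s) (Polynomial.hermite r) * ((∑ k ∈ edgeworthTuples d r,
        ∏ j : Finset.Icc 3 (2 * d + 1), a j ^ k j / ((k j).factorial : ℝ)) / s ^ r))) : ℝ) := by
  simp_rw [gaussian_mul_edgeworthPoly_eq]
  rw [integral_add (integrable_gaussian_mul_pow_mul_cexp hs 0 l) (integrable_finsetSum _ fun r _ =>
    (integrable_gaussian_mul_pow_mul_cexp hs r l).const_mul _), integral_finsetSum _ fun r _ =>
    (integrable_gaussian_mul_pow_mul_cexp hs r l).const_mul _]
  simp_rw [integral_const_mul, integral_gaussian_mul_pow_mul_cexp hs]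
  simp_rw [← Complex.ofReal_mul]
  rw [← Complex.ofReal_sum, ← Complex.ofReal_add]
  congr 1
  rw [mul_add, mul_add, Finset.mul_sum, Finset.mul_sum]
  congr 1
  · simp
  · exact Finset.sum_congr rfl fun r _ => by ring

/-- The normalisations `s^j` combine to `s^r` because `∑ j k_j = r`. -/
theorem edgeworthCorrection_eq {Ω : Type u} [MeasurableSpace Ω] (X : Ω → ℝ) (μ : Measure Ω)
    (d : ℕ) (x : ℝ) :
    edgeworthCorrection X μ d x = ∑ r ∈ Finset.Icc 3 (6 * d),
      Polynomial.aeval x (Polynomial.hermite r) * ((∑ k ∈ edgeworthTuples d r,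
        ∏ j : Finset.Icc 3 (2 * d + 1), (cumulant X μ j / (j : ℕ).factorial) ^ k j /
          ((k j).factorial : ℝ)) / √(variance X μ) ^ r) := by
  refine Finset.sum_congr rfl fun r _ => ?_
  congr 1
  rw [Finset.sum_div]
  refine Finset.sum_congr rfl fun k hk => ?_
  rw [← (mem_edgeworthTuples.1 hk).1, ← Finset.prod_pow_eq_pow_sum, ← Finset.prod_div_distrib]
  refine Finset.prod_congr rfl fun j _ => ?_
  rw [normCumulant, mul_comm (k j), pow_mul, div_right_comm, ← div_pow, div_div]

theorem integrable_abs_pow_mul_exp_neg_mul_sq {b : ℝ} (hb : 0 < b) (k : ℕ) :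
    Integrable fun t : ℝ => |t| ^ k * Real.exp (-(b * t ^ 2)) := by
  refine (integrable_pow_mul_exp_neg_mul_sq hb k).norm.congr (Filter.Eventually.of_forall fun t => ?_)
  simp

/-- The substitution `t ↦ √n t` is the source of every power of `n` in the Fourier error. -/
theorem integral_abs_pow_mul_exp_neg_mul_sq (b : ℝ) {n : ℝ} (hn : 0 < n) (k : ℕ) :
    ∫ t : ℝ, |t| ^ k * Real.exp (-(b * n * t ^ 2)) =
      (∫ t : ℝ, |t| ^ k * Real.exp (-(b * t ^ 2))) / √n ^ (k + 1) := by
  have hs : 0 < √n := Real.sqrt_pos.2 hn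
  have h := Measure.integral_comp_mul_left
    (fun t : ℝ => |t| ^ k * Real.exp (-(b * t ^ 2))) √n
  have h1 : ∀ t : ℝ, |t| ^ k * Real.exp (-(b * n * t ^ 2)) =
      (√n ^ k)⁻¹ * (|√n * t| ^ k * Real.exp (-(b * (√n * t) ^ 2))) := by
    intro t
    rw [mul_pow √n t 2, Real.sq_sqrt hn.le, abs_mul, abs_of_pos hs, mul_pow]
    field_simp
  simp_rw [h1]
  rw [integral_const_mul, h, abs_of_pos (inv_pos.2 hs), smul_eq_mul, pow_succ]
  field_simp

/-- Pointwise comparison, on the whole line, of the truncated characteristic function of the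
centred variable with its Edgeworth approximation. -/
theorem norm_indicator_sub_gaussian_mul_edgeworthPoly_le {a : ℕ → ℝ} {B c r₁ t₀ : ℝ}
    (hB : 0 ≤ B) (hcpos : 0 ≤ c) (ht₀ : 0 < t₀) (ht₀π : t₀ ≤ Real.pi)
    (hr₁ : 0 < r₁) (hq : t₀ / r₁ ≤ 1 / 2) (hc : 16 * B * t₀ ≤ c * r₁ ^ 3)
    (ha : ∀ j, |a j| ≤ B / r₁ ^ j) (ha0 : a 0 = 0) (hac : c ≤ 2 * a 2) (d : ℕ) {ψ : ℝ → ℂ}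
    (hdecay : ∀ t : ℝ, |t| ≤ Real.pi → ‖ψ t‖ ≤ Real.exp (-(c * t ^ 2)))
    (hexp : ∀ t : ℝ, |t| ≤ t₀ → ∃ S, HasSum (fun j : ℕ => (a j : ℂ) * (t * Complex.I) ^ j) S ∧
      ψ t = Complex.exp (S - a 1 * (t * Complex.I))) (t : ℝ) :
    ‖(Set.Ioc (-Real.pi) Real.pi).indicator ψ t -
        Complex.exp (-(a 2 * t ^ 2 : ℝ)) * edgeworthPoly a d (t * Complex.I)‖ ≤
      (2 / t₀ ^ (2 * d + 1) * |t| ^ (2 * d + 1) +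
        2 * B / r₁ ^ (2 * d + 2) * |t| ^ (2 * d + 2)) * Real.exp (-(c / 4 * t ^ 2)) := by
  have hform : (2 / t₀ ^ (2 * d + 1) * |t| ^ (2 * d + 1) +
        2 * B / r₁ ^ (2 * d + 2) * |t| ^ (2 * d + 2)) * Real.exp (-(c / 4 * t ^ 2)) =
      (2 * (|t| / t₀) ^ (2 * d + 1) + 2 * B * (|t| / r₁) ^ (2 * d + 2)) *
        Real.exp (-(c * t ^ 2 / 4)) := by
    rw [div_pow, div_pow]; ring_nf
  rw [hform]
  have hct : 0 ≤ c * t ^ 2 := by positivity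
  rcases lt_or_ge |t| t₀ with ht | ht
  · have htp := abs_lt.1 (ht.trans_le ht₀π)
    obtain ⟨S, hS, hψ⟩ := hexp t ht.le
    rw [Set.indicator_of_mem (Set.mem_Ioc.2 ⟨htp.1, htp.2.le⟩), hψ]
    refine (norm_cexp_sub_gaussian_mul_edgeworthPoly_le hB ht₀ hr₁ hq hc ha ha0 hac d ht.le hS).trans ?_
    gcongr
    exact le_mul_of_one_le_left (by positivity) one_le_two
  -- Away from the origin both functions are small separately. The factor `(|t|/t₀)^(2d+1) ≥ 1` puts
  -- this tail in the form of the main error, so it needs no integral of its own.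
  · have hθ : 1 ≤ |t| / t₀ := (one_le_div ht₀).2 ht
    have h1 : ‖(Set.Ioc (-Real.pi) Real.pi).indicator ψ t‖ ≤
        (|t| / t₀) ^ (2 * d + 1) * Real.exp (-(c * t ^ 2 / 4)) := by
      by_cases hmem : t ∈ Set.Ioc (-Real.pi) Real.pi
      · rw [Set.indicator_of_mem hmem]
        refine (hdecay t (abs_le.2 ⟨hmem.1.le, hmem.2⟩)).trans ?_
        refine le_trans ?_ (le_mul_of_one_le_left (Real.exp_pos _).le (one_le_pow₀ hθ))
        exact Real.exp_le_exp.2 (by linarith)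
      · rw [Set.indicator_of_notMem hmem, norm_zero]
        positivity
    have h2 : ‖Complex.exp (-(a 2 * t ^ 2 : ℝ)) * edgeworthPoly a d (t * Complex.I)‖ ≤
        (|t| / t₀) ^ (2 * d + 1) * Real.exp (-(c * t ^ 2 / 4)) := by
      rw [norm_mul, Complex.norm_exp, ← Complex.ofReal_neg, Complex.ofReal_re]
      calc _ ≤ Real.exp (-(c * t ^ 2 / 2)) *
            ((|t| / t₀) ^ (2 * d + 1) * Real.exp (c * t ^ 2 / 8)) := by
            gcongr
            · nlinarith [sq_nonneg t]
            · exact norm_edgeworthPoly_le hB ht₀ hr₁ hq hc ha d ht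
        _ = (|t| / t₀) ^ (2 * d + 1) * Real.exp (-(c * t ^ 2 / 2) + c * t ^ 2 / 8) := by
            rw [Real.exp_add]; ring
        _ ≤ _ := by
            gcongr
            linarith
    calc _ ≤ _ := norm_sub_le _ _
      _ ≤ (|t| / t₀) ^ (2 * d + 1) * Real.exp (-(c * t ^ 2 / 4)) +
          (|t| / t₀) ^ (2 * d + 1) * Real.exp (-(c * t ^ 2 / 4)) := add_le_add h1 h2
      _ = 2 * (|t| / t₀) ^ (2 * d + 1) * Real.exp (-(c * t ^ 2 / 4)) := by ring
      _ ≤ _ := by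
          gcongr
          exact le_add_of_nonneg_right (by positivity)

/-! ### The abstract local limit theorem. -/

/-- The class of counting variables to which the local limit theorem applies: at most `n`, with a
moment generating function that has no zero near the origin and with Gaussian decay of the
characteristic function. -/
structure ZeroFreeCount {Ω : Type u} [MeasurableSpace Ω] (μ : Measure Ω) (N : Ω → ℕ) (n : ℕ)
    (c r : ℝ) : Prop where
  one_le : 1 ≤ n
  le : ∀ ω, N ω ≤ n
  ne_zero : ∀ z ∈ Metric.ball (0 : ℂ) r, complexMGF (fun ω => (N ω : ℝ)) μ z ≠ 0
  decay : ∀ t : ℝ, |t| ≤ Real.pi →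
    ‖complexMGF (fun ω => (N ω : ℝ)) μ (t * Complex.I)‖ ≤ Real.exp (-(c * n * t ^ 2))

section LocalLimit

variable {Ω : Type u} [Fintype Ω] [MeasurableSpace Ω] [MeasurableSingletonClass Ω]
  {μ : Measure Ω} [IsProbabilityMeasure μ] {N : Ω → ℕ} {n : ℕ} {c r : ℝ}

theorem ZeroFreeCount.variance_ge (h : ZeroFreeCount μ N n c r) (hc : 0 < c) :
    2 * (c * n) ≤ variance (fun ω => (N ω : ℝ)) μ :=
  two_mul_le_variance _ (by positivity) h.decay

theorem ZeroFreeCount.cumulant_expansion (h : ZeroFreeCount μ N n c r) (hr : 0 < r) :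
    (∀ j, |cumulant (fun ω => (N ω : ℝ)) μ j / j.factorial| ≤ 2 * (n * r) / (r / 2) ^ j) ∧
    ∀ z ∈ Metric.ball (0 : ℂ) (r / 2), ∃ S,
      HasSum (fun j : ℕ => ((cumulant (fun ω => (N ω : ℝ)) μ j / j.factorial : ℝ) : ℂ) * z ^ j) S ∧
        Complex.exp S = complexMGF (fun ω => (N ω : ℝ)) μ z := by
  have hn : (0 : ℝ) < n := by exact_mod_cast h.one_le
  obtain ⟨h1, h2⟩ := _root_.cumulant_expansion (integrableExpSet_eq_univ_of_finite _) hr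
    (mul_pos hn hr) (fun z hz => norm_complexMGF_le_exp h.le (mem_ball_zero_iff.1 hz).le) h.ne_zero
  refine ⟨fun j => ?_, h2⟩
  rw [abs_div, Nat.abs_cast, div_le_iff₀ (by positivity)]
  refine (h1 j).trans_eq (by ring)

end LocalLimit

/-- The local limit theorem with Edgeworth corrections. -/
theorem exists_local_limit_bound {c r : ℝ} (hc : 0 < c) (hr : 0 < r) (d : ℕ) :
    ∃ K : ℝ, 0 ≤ K ∧ ∀ (Ω : Type u) [Fintype Ω] [MeasurableSpace Ω] [MeasurableSingletonClass Ω]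
      (μ : Measure Ω) [IsProbabilityMeasure μ] (N : Ω → ℕ) (n : ℕ), ZeroFreeCount μ N n c r →
      ∀ (m : ℕ) (l : ℝ), (∫ ω, (N ω : ℝ) ∂μ) + l = m →
        |μ.real {ω | N ω = m} - gaussianDensity √(variance (fun ω => (N ω : ℝ)) μ) l *
          (1 + edgeworthCorrection (fun ω => (N ω : ℝ)) μ d
            (l / √(variance (fun ω => (N ω : ℝ)) μ)))| ≤ K / √n ^ (2 * d + 1) := by
  set r₁ : ℝ := r / 2 with hr₁def
  have hr₁ : 0 < r₁ := by positivity
  -- The three bounds keep `t` in the inversion interval, make `t₀/r₁ ≤ 1/2`, and give `16 B t₀ ≤ c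
  -- n r₁³` for `B = 2nr`, where `n` cancels.
  set t₀ : ℝ := min Real.pi (min (r₁ / 2) (c * r₁ ^ 3 / (32 * r))) with ht₀def
  have ht₀ : 0 < t₀ := by have := Real.pi_pos; positivity
  have ht₀π : t₀ ≤ Real.pi := min_le_left _ _
  have ht₀r : t₀ ≤ r₁ / 2 := (min_le_right _ _).trans (min_le_left _ _)
  have ht₀c : t₀ ≤ c * r₁ ^ 3 / (32 * r) := (min_le_right _ _).trans (min_le_right _ _)
  set I₁ : ℝ := ∫ t : ℝ, |t| ^ (2 * d + 1) * Real.exp (-(c / 4 * t ^ 2)) with hI₁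
  set I₂ : ℝ := ∫ t : ℝ, |t| ^ (2 * d + 2) * Real.exp (-(c / 4 * t ^ 2)) with hI₂
  have hI₁0 : 0 ≤ I₁ := integral_nonneg fun t => by positivity
  have hI₂0 : 0 ≤ I₂ := integral_nonneg fun t => by positivity
  set K₁ : ℝ := 2 / t₀ ^ (2 * d + 1) with hK₁
  -- This is `2B / r₁^(2d+2)` with `B = 2nr` and the factor `n` taken out.
  set K₂ : ℝ := 4 * r / r₁ ^ (2 * d + 2) with hK₂
  have hK₁0 : 0 ≤ K₁ := by positivity
  have hK₂0 : 0 ≤ K₂ := by positivity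
  refine ⟨K₁ * I₁ + K₂ * I₂, by positivity, ?_⟩
  intro Ω _ _ _ μ _ N n h m l hl
  have hn1 : (1 : ℝ) ≤ n := by exact_mod_cast h.one_le
  have hn : (0 : ℝ) < n := by linarith
  have hsn : 1 ≤ √(n : ℝ) := Real.one_le_sqrt.2 hn1
  set X : Ω → ℝ := fun ω => (N ω : ℝ) with hX
  obtain ⟨ha, hS⟩ := h.cumulant_expansion hr
  have hvar := h.variance_ge hc
  set s : ℝ := √(variance X μ) with hs
  have hs2 : s ^ 2 = variance X μ := Real.sq_sqrt (by nlinarith [mul_pos hc hn])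
  have hspos : 0 < s := Real.sqrt_pos.2 (by nlinarith [mul_pos hc hn])
  set a : ℕ → ℝ := fun j => cumulant X μ j / j.factorial with hadef
  have ha0 : a 0 = 0 := by simp [hadef, cumulant_zero]
  have ha1 : a 1 = ∫ ω, X ω ∂μ := by simp [hadef, cumulant_one]
  have ha2 : a 2 = s ^ 2 / 2 := by simp [hadef, cumulant_two, hs2]
  set ψ : ℝ → ℂ := fun t => complexMGF X μ (t * Complex.I) *
    Complex.exp (-(a 1 * (t * Complex.I))) with hψ
  have hψn : ∀ t, ‖ψ t‖ = ‖complexMGF X μ (t * Complex.I)‖ := by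
    intro t
    have : (-(a 1 * (t * Complex.I)) : ℂ) = ((-(a 1 * t) : ℝ) : ℂ) * Complex.I := by
      push_cast; ring
    rw [hψ]
    beta_reduce
    rw [this, norm_mul, Complex.norm_exp_ofReal_mul_I, mul_one]
  have hpoint := norm_indicator_sub_gaussian_mul_edgeworthPoly_le (a := a) (B := 2 * (n * r))
    (c := c * n) (r₁ := r₁) (t₀ := t₀) (by positivity) (by positivity) ht₀ ht₀π hr₁
    (by rw [div_le_iff₀ hr₁]; linarith)
    (by
      rw [le_div_iff₀ (by positivity)] at ht₀c
      nlinarith)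
    ha ha0 (by rw [ha2, hs2]; nlinarith [mul_pos hc hn]) d (ψ := ψ)
    (fun t ht => (hψn t).trans_le (h.decay t ht))
    (fun t ht => by
      obtain ⟨S, hS1, hS2⟩ := hS (t * Complex.I) (by simp; linarith)
      exact ⟨S, hS1, by rw [sub_eq_add_neg, Complex.exp_add, hS2]⟩)
  have hψc : Continuous ψ := by
    have := continuous_complexMGF (μ := μ) X
    fun_prop
  -- The indicator extends the inversion integral to the line, and `m = E[X] + l` moves the centring
  -- into `ψ`.
  have hleft : (2 * Real.pi * μ.real {ω | N ω = m} : ℂ) =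
      ∫ t : ℝ, (Set.Ioc (-Real.pi) Real.pi).indicator ψ t * Complex.exp (-(t * l * Complex.I)) := by
    rw [← integral_complexMGF_mul_exp, intervalIntegral.integral_of_le (by linarith [Real.pi_pos]),
      ← integral_indicator measurableSet_Ioc]
    refine integral_congr_ae (Filter.Eventually.of_forall fun t => ?_)
    beta_reduce
    by_cases ht : t ∈ Set.Ioc (-Real.pi) Real.pi
    · rw [Set.indicator_of_mem ht, Set.indicator_of_mem ht, hψ]
      beta_reduce
      rw [mul_assoc (complexMGF _ _ _), ← Complex.exp_add]
      congr 2
      rw [ha1, ← Complex.ofReal_natCast, ← hl]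
      push_cast
      ring
    · rw [Set.indicator_of_notMem ht, Set.indicator_of_notMem ht, zero_mul]
  have hright := integral_gaussian_mul_edgeworthPoly a d hspos l
  have hintl : Integrable fun t : ℝ => (Set.Ioc (-Real.pi) Real.pi).indicator ψ t *
      Complex.exp (-(t * l * Complex.I)) := by
    have : (fun t : ℝ => (Set.Ioc (-Real.pi) Real.pi).indicator ψ t *
        Complex.exp (-(t * l * Complex.I))) = (Set.Ioc (-Real.pi) Real.pi).indicator
        fun t => ψ t * Complex.exp (-(t * l * Complex.I)) := by
      ext t
      simp only [Set.indicator_apply]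
      split_ifs <;> simp
    rw [this, integrable_indicator_iff measurableSet_Ioc]
    exact (Continuous.integrableOn_Icc (by fun_prop)).mono_set Set.Ioc_subset_Icc_self
  have hintr := integrable_gaussian_mul_edgeworthPoly a d hspos l
  rw [edgeworthCorrection_eq]
  set G : ℝ := gaussianDensity s l * (1 + ∑ r ∈ Finset.Icc 3 (6 * d),
      Polynomial.aeval (l / s) (Polynomial.hermite r) * ((∑ k ∈ edgeworthTuples d r,
        ∏ j : Finset.Icc 3 (2 * d + 1), a j ^ k j / ((k j).factorial : ℝ)) / s ^ r)) with hG
  change |μ.real {ω | N ω = m} - G| ≤ _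
  have hi1 := integrable_abs_pow_mul_exp_neg_mul_sq (b := c / 4 * n) (by positivity) (2 * d + 1)
  have hi2 := integrable_abs_pow_mul_exp_neg_mul_sq (b := c / 4 * n) (by positivity) (2 * d + 2)
  have hdiff : ‖((2 * Real.pi * (μ.real {ω | N ω = m} - G) : ℝ) : ℂ)‖ ≤
      ∫ t : ℝ, (K₁ * (|t| ^ (2 * d + 1) * Real.exp (-(c / 4 * n * t ^ 2))) +
        K₂ * n * (|t| ^ (2 * d + 2) * Real.exp (-(c / 4 * n * t ^ 2)))) := by
    have : ((2 * Real.pi * (μ.real {ω | N ω = m} - G) : ℝ) : ℂ) =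
        (2 * Real.pi * μ.real {ω | N ω = m} : ℂ) - (2 * Real.pi * G : ℝ) := by push_cast; ring
    rw [this, hleft, ← hright, ← integral_sub hintl hintr]
    refine norm_integral_le_of_norm_le ((hi1.const_mul _).add (hi2.const_mul _))
      (Filter.Eventually.of_forall fun t => ?_)
    have e1 : -(t * l * Complex.I : ℂ) = ((-(t * l) : ℝ) : ℂ) * Complex.I := by push_cast; ring
    rw [← sub_mul, norm_mul, e1, Complex.norm_exp_ofReal_mul_I, mul_one, ← ha2]
    refine (hpoint t).trans_eq ?_
    rw [hK₁, hK₂]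
    have e2 : c * n / 4 = c / 4 * n := by ring
    rw [e2]
    ring
  rw [integral_add (hi1.const_mul _) (hi2.const_mul _), integral_const_mul, integral_const_mul,
    integral_abs_pow_mul_exp_neg_mul_sq _ hn, integral_abs_pow_mul_exp_neg_mul_sq _ hn,
    Complex.norm_real, Real.norm_eq_abs, abs_mul, abs_of_pos (by positivity : 0 < 2 * Real.pi),
    ← hI₁, ← hI₂] at hdiff
  have hpi : 1 ≤ 2 * Real.pi := by linarith [Real.pi_gt_three]
  calc |μ.real {ω | N ω = m} - G| ≤ 2 * Real.pi * |μ.real {ω | N ω = m} - G| :=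
        le_mul_of_one_le_left (abs_nonneg _) hpi
    _ ≤ _ := hdiff
    -- The first term has half a power of `n` to spare; in the second, the extra `n` cancels two
    -- powers of `√n`.
    _ ≤ K₁ * (I₁ / √n ^ (2 * d + 1)) + K₂ * (I₂ / √n ^ (2 * d + 1)) := by
        refine add_le_add ?_ (le_of_eq ?_)
        · gcongr
          omega
        · have e3 : √(n : ℝ) ^ (2 * d + 2 + 1) = √(n : ℝ) ^ (2 * d + 1) * n := by
            rw [show 2 * d + 2 + 1 = (2 * d + 1) + 2 by ring, pow_add, Real.sq_sqrt hn.le]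
          rw [e3]
          have : 0 < √(n : ℝ) := by linarith
          field_simp
    _ = _ := by ring

/-! ### Decay of the characteristic function by conditioning. -/

section Conditioning

variable {V : Type u} [Fintype V] [DecidableEq V]

/-- Flipping the spin at `v` is an involution, so twice each sum is a sum over pairs. This lets a
single spin be averaged out. -/
theorem sum_eq_sum_of_update_pair {M : Type*} [AddCommGroup M] [Module ℚ M]
    {f g : (V → Bool) → M} (v : V)
    (h : ∀ σ, f (Function.update σ v true) + f (Function.update σ v false) =
      g (Function.update σ v true) + g (Function.update σ v false)) :
    ∑ σ, f σ = ∑ σ, g σ := by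
  have hinv : Function.Involutive fun σ : V → Bool => Function.update σ v (!σ v) := by
    intro σ
    simp
  have key : ∀ f : (V → Bool) → M, (2 : ℚ) • ∑ σ, f σ =
      ∑ σ, (f (Function.update σ v true) + f (Function.update σ v false)) := by
    intro f
    rw [two_smul]
    nth_rewrite 2 [← Equiv.sum_comp hinv.toPerm f]
    rw [← Finset.sum_add_distrib]
    refine Finset.sum_congr rfl fun σ _ => ?_
    have hσ := Function.update_eq_self v σ
    cases hb : σ v
    · rw [hb] at hσ
      simp only [Function.Involutive.coe_toPerm, hb, Bool.not_false, hσ]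
      exact add_comm _ _
    · rw [hb] at hσ
      simp only [Function.Involutive.coe_toPerm, hb, Bool.not_true, hσ]
  have h2 : (2 : ℚ) • ∑ σ, f σ = (2 : ℚ) • ∑ σ, g σ := by
    rw [key, key]
    exact Finset.sum_congr rfl fun σ _ => h σ
  have := congrArg (fun x => (2⁻¹ : ℚ) • x) h2
  simpa only [smul_smul, inv_mul_cancel₀ (two_ne_zero' ℚ), one_smul] using this

/-- Conditionally on the spins outside `I`, the spins in `I` are independent; averaging over each of
them gains a factor `q`. -/
theorem norm_sum_mul_prod_le {w : (V → Bool) → ℝ} (hw : ∀ σ, 0 ≤ w σ) {R : V → (V → Bool) → ℝ}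
    {z : ℂ} {q : ℝ} (hq0 : 0 ≤ q) (I : Finset V) (hR : ∀ v ∈ I, ∀ σ, 0 ≤ R v σ)
    (hRI : ∀ v ∈ I, ∀ u ∈ I, ∀ σ b, R v (Function.update σ u b) = R v σ)
    (hwR : ∀ v ∈ I, ∀ σ, w (Function.update σ v true) = R v σ * w (Function.update σ v false))
    (hq : ∀ v ∈ I, ∀ σ, ‖1 + R v σ * z‖ ≤ q * (1 + R v σ)) (F : (V → Bool) → ℂ)
    (hF : ∀ u ∈ I, ∀ σ b, F (Function.update σ u b) = F σ) :
    ‖∑ σ, (w σ : ℂ) * F σ * ∏ v ∈ I, (if σ v then z else 1)‖ ≤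
      q ^ I.card * ∑ σ, w σ * ‖F σ‖ := by
  induction I using Finset.induction_on generalizing F with
  | empty =>
    simp only [Finset.prod_empty, mul_one, Finset.card_empty, pow_zero, one_mul]
    refine norm_sum_le_of_le _ fun σ _ => ?_
    rw [norm_mul, Complex.norm_real, Real.norm_eq_abs, abs_of_nonneg (hw σ)]
  | insert v J hv ih =>
    have hvI := Finset.mem_insert_self v J
    have hJ : ∀ {u}, u ∈ J → u ∈ insert v J := fun h => Finset.mem_insert_of_mem h
    have h1R : ∀ σ, (1 + R v σ : ℂ) ≠ 0 := fun σ => by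
      have := hR v hvI σ
      exact_mod_cast (by linarith : (0 : ℝ) < 1 + R v σ).ne'
    -- The factor at `v` is replaced by its conditional mean `(1 + Rz)/(1 + R)`. By `hRI` that mean
    -- does not depend on the spins in `J`, so the induction hypothesis applies to `F'`.
    set F' : (V → Bool) → ℂ := fun σ => F σ * ((1 + R v σ * z) / (1 + R v σ)) with hF'
    have hstep : ∑ σ, (w σ : ℂ) * F σ * ∏ u ∈ insert v J, (if σ u then z else 1) =
        ∑ σ, (w σ : ℂ) * F' σ * ∏ u ∈ J, (if σ u then z else 1) := by
      refine sum_eq_sum_of_update_pair v fun σ => ?_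
      have hprod : ∀ b, ∏ u ∈ J, (if Function.update σ v b u then z else 1) =
          ∏ u ∈ J, (if σ u then z else 1) := by
        intro b
        refine Finset.prod_congr rfl fun u hu => ?_
        rw [Function.update_of_ne (ne_of_mem_of_not_mem hu hv)]
      simp only [Finset.prod_insert hv, hprod, hF', hF v hvI, hRI v hvI v hvI, hwR v hvI,
        Function.update_self, if_true, Bool.false_eq_true, if_false]
      have := h1R σ
      push_cast
      field_simp
      ring
    rw [hstep]
    refine (ih (fun u hu => hR u (hJ hu)) (fun u hu u' hu' => hRI u (hJ hu) u' (hJ hu'))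
      (fun u hu => hwR u (hJ hu)) (fun u hu => hq u (hJ hu)) F' (fun u hu σ b => ?_)).trans ?_
    · simp only [hF', hF u (hJ hu), hRI v hvI u (hJ hu)]
    · rw [Finset.card_insert_of_notMem hv, pow_succ, mul_assoc, Finset.mul_sum _ _ q]
      refine mul_le_mul_of_nonneg_left (Finset.sum_le_sum fun σ _ => ?_) (pow_nonneg hq0 _)
      have hpos : 0 < 1 + R v σ := by linarith [hR v hvI σ]
      have hn : ‖(1 + R v σ : ℂ)‖ = 1 + R v σ := by
        rw [← Complex.ofReal_one, ← Complex.ofReal_add, Complex.norm_real, Real.norm_eq_abs,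
          abs_of_pos hpos]
      have hle : ‖(1 + R v σ * z) / (1 + R v σ : ℂ)‖ ≤ q := by
        rw [norm_div, hn, div_le_iff₀ hpos]
        exact hq v hvI σ
      rw [hF', norm_mul]
      calc w σ * (‖F σ‖ * ‖(1 + R v σ * z) / (1 + R v σ : ℂ)‖) ≤ w σ * (‖F σ‖ * q) := by
            have := hw σ
            gcongr
        _ = q * (w σ * ‖F σ‖) := by ring

/-- `|1 + Re^{it}|² = (1+R)² - 2R(1 - cos t)` and `1 - cos t ≥ 2t²/π²` on `[-π, π]`; `p` is a lower
bound for the Bernoulli variance `R/(1+R)²`. -/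
theorem norm_one_add_mul_exp_le {R p t : ℝ} (hR : 0 ≤ R) (hp : p * (1 + R) ^ 2 ≤ R)
    (ht : |t| ≤ Real.pi) :
    ‖1 + R * Complex.exp (t * Complex.I)‖ ≤
      Real.exp (-(2 * p / Real.pi ^ 2 * t ^ 2)) * (1 + R) := by
  have hcos := Real.cos_le_one_sub_mul_cos_sq ht
  have hsq : ‖1 + R * Complex.exp (t * Complex.I)‖ ^ 2 = (1 + R) ^ 2 - 2 * R * (1 - Real.cos t) := by
    rw [Complex.sq_norm, Complex.normSq_apply]
    simp only [Complex.add_re, Complex.one_re, Complex.re_ofReal_mul, Complex.exp_ofReal_mul_I_re,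
      Complex.add_im, Complex.one_im, Complex.im_ofReal_mul, Complex.exp_ofReal_mul_I_im]
    linear_combination R ^ 2 * Real.sin_sq_add_cos_sq t
  refine abs_le_of_sq_le_sq' ?_ (by positivity) |>.2
  rw [hsq, mul_pow, ← Real.exp_nat_mul]
  have hx := Real.add_one_le_exp (((2 : ℕ) : ℝ) * -(2 * p / Real.pi ^ 2 * t ^ 2))
  have h1 : (1 - 2 * p * (2 / Real.pi ^ 2 * t ^ 2)) * (1 + R) ^ 2 ≤
      Real.exp (((2 : ℕ) : ℝ) * -(2 * p / Real.pi ^ 2 * t ^ 2)) * (1 + R) ^ 2 := by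
    refine mul_le_mul_of_nonneg_right (le_trans (le_of_eq ?_) hx) (sq_nonneg _)
    push_cast
    ring
  refine le_trans ?_ h1
  have h2 : 0 ≤ 2 / Real.pi ^ 2 * t ^ 2 := by positivity
  nlinarith [mul_le_mul_of_nonneg_right hp h2]

end Conditioning

/-! ### Independent sets and monochromatic edges. -/

section Graph

variable {V : Type u} [Fintype V] [DecidableEq V]

/-- Greedy choice: each selected vertex discards itself and at most `Δ` neighbours. -/
theorem exists_independent_subset {G : SimpleGraph V} {Δ : ℕ} (hG : DegreeAtMost G Δ)
    (S : Finset V) :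
    ∃ I ⊆ S, (∀ u ∈ I, ∀ v ∈ I, ¬ G.Adj u v) ∧ S.card ≤ I.card * (Δ + 1) := by
  classical
  induction S using Finset.strongInduction with
  | H S ih =>
    rcases S.eq_empty_or_nonempty with rfl | ⟨v, hv⟩
    · exact ⟨∅, Finset.Subset.refl _, by simp, by simp⟩
    · set S' := S.filter fun u => u ≠ v ∧ ¬ G.Adj v u with hS'
      have hlt : S' ⊂ S := by
        refine (Finset.filter_ssubset).2 ⟨v, hv, by simp⟩
      obtain ⟨I, hIS, hI, hcard⟩ := ih S' hlt
      have hmem : ∀ u ∈ I, u ≠ v ∧ ¬ G.Adj v u := fun u hu => (Finset.mem_filter.1 (hIS hu)).2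
      have hvI : v ∉ I := fun h => (hmem v h).1 rfl
      refine ⟨insert v I, ?_, ?_, ?_⟩
      · intro u hu
        rcases Finset.mem_insert.1 hu with rfl | hu
        · exact hv
        · exact hlt.1 (hIS hu)
      · intro u hu u' hu'
        rcases Finset.mem_insert.1 hu with e | h <;> rcases Finset.mem_insert.1 hu' with e' | h'
        · rw [e, e']
          exact G.loopless.irrefl _
        · exact e ▸ (hmem u' h').2
        · exact fun hadj => (hmem u h).2 (e' ▸ hadj.symm)
        · exact hI u h u' h'
      · have hsub : S ⊆ S' ∪ insert v (G.neighborFinset v) := by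
          intro u hu
          simp only [hS', Finset.mem_union, Finset.mem_filter, Finset.mem_insert,
            SimpleGraph.mem_neighborFinset]
          tauto
        have hdeg : (G.neighborFinset v).card ≤ Δ := by
          have := hG v
          rwa [Set.ncard_eq_toFinset_card'] at this
        have h1 := (Finset.card_le_card hsub).trans (Finset.card_union_le _ _)
        have h2 := Finset.card_insert_le v (G.neighborFinset v)
        rw [Finset.card_insert_of_notMem hvI, add_mul]
        omega

/-- Only the edges at `v` depend on `b`; the first summand cancels in the ratio of the two weights.
-/
theorem monoEdges_update (G : SimpleGraph V) (σ : V → Spin) (v : V) (b : Spin) :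
    monoEdges G (Function.update σ v b) =
      {e : Sym2 V | e ∈ G.edgeSet ∧ v ∉ e ∧ (e.map σ).IsDiag}.ncard +
        {u : V | G.Adj v u ∧ σ u = b}.ncard := by
  have hinj : Function.Injective fun u : V => s(v, u) := fun u u' h => Sym2.congr_right.1 h
  rw [monoEdges, ← Set.ncard_image_of_injective _ hinj, ← Set.ncard_union_eq]
  · congr 1
    ext e
    induction e with | _ x y
    simp only [Set.mem_ofPred_eq, Set.mem_union, Set.mem_image, SimpleGraph.mem_edgeSet,
      Sym2.map_mk, Sym2.mk_isDiag_iff, Sym2.mem_iff, Sym2.eq_iff]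
    by_cases hx : x = v
    · subst hx
      by_cases hy : y = x
      · subst hy
        simp
      · have hy' : x ≠ y := fun h => hy h.symm
        simp [hy, hy', eq_comm]
    · have hx' : v ≠ x := fun h => hx h.symm
      by_cases hy : y = v
      · subst hy
        simp [hx, hx', G.adj_comm]
      · have hy' : v ≠ y := fun h => hy h.symm
        simp [hx, hx', hy, hy']
  · rw [Set.disjoint_left]
    rintro e ⟨-, hv, -⟩ ⟨u, -, rfl⟩
    exact hv (Sym2.mem_mk_left v u)

end Graph

/-! ### The Ising model as a zero-free count. -/

section Ising

variable {V : Type u} [Fintype V] [DecidableEq V]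

/-- The ratio of the Ising weights of the two spins at `v`, given the spins at its neighbours. -/
noncomputable def spinRatio (G : SimpleGraph V) (β lam : ℝ) (v : V) (σ : V → Spin) : ℝ :=
  lam * Real.exp (β * (({u : V | G.Adj v u ∧ σ u = Spin.plus}.ncard : ℝ) -
    ({u : V | G.Adj v u ∧ σ u = false}.ncard : ℝ)))

theorem plusCount_update (σ : V → Spin) (v : V) :
    plusCount (Function.update σ v true) = plusCount (Function.update σ v false) + 1 := by
  have h1 : (Finset.univ.filter fun u => Function.update σ v true u = Spin.plus) =
      insert v (Finset.univ.filter fun u => Function.update σ v false u = Spin.plus) := by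
    ext u
    by_cases hu : u = v
    · subst hu; simp
    · simp [hu]
  rw [plusCount, plusCount, h1, Finset.card_insert_of_notMem (by simp)]

theorem isingWeight_update (G : SimpleGraph V) (β lam : ℝ) (σ : V → Spin) (v : V) :
    isingWeight ℝ G β lam (Function.update σ v true) =
      spinRatio G β lam v σ * isingWeight ℝ G β lam (Function.update σ v false) := by
  simp only [isingWeight, spinRatio, plusCount_update, monoEdges_update, RCLike.ofReal_real_eq_id,
    id, pow_succ]
  have : ∀ a b c : ℝ, Real.exp (β * (a + b)) = Real.exp (β * (b - c)) * Real.exp (β * (a + c)) := by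
    intro a b c
    rw [← Real.exp_add]; ring_nf
  push_cast
  rw [this _ _ ({u : V | G.Adj v u ∧ σ u = false}.ncard : ℝ)]
  ring

-- Covers `u = v` as well, because the graph has no loops.
omit [Fintype V] in
theorem spinRatio_update {G : SimpleGraph V} (β lam : ℝ) {v u : V} (h : ¬ G.Adj v u)
    (σ : V → Spin) (b : Spin) :
    spinRatio G β lam v (Function.update σ u b) = spinRatio G β lam v σ := by
  have key : ∀ c : Spin, {w : V | G.Adj v w ∧ Function.update σ u b w = c} =
      {w : V | G.Adj v w ∧ σ w = c} := by
    intro c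
    ext w
    refine and_congr_right fun hw => ?_
    rw [Function.update_of_ne]
    rintro rfl
    exact h hw
  rw [spinRatio, spinRatio, key, key]

omit [DecidableEq V] in
theorem spinRatio_mem_Icc {G : SimpleGraph V} {Δ : ℕ} (hG : DegreeAtMost G Δ) {β : ℝ} (hβ : 0 ≤ β)
    {lam : ℝ} (hlam : 0 < lam) (v : V) (σ : V → Spin) :
    spinRatio G β lam v σ ∈ Set.Icc (lam * Real.exp (-(β * Δ))) (lam * Real.exp (β * Δ)) := by
  have hle : ∀ c : Spin, ({u : V | G.Adj v u ∧ σ u = c}.ncard : ℝ) ≤ Δ := fun c => by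
    exact_mod_cast (Set.ncard_le_ncard (Set.sep_subset (G.neighborSet v) _) (Set.toFinite _)).trans (hG v)
  have h0 : ∀ c : Spin, (0 : ℝ) ≤ ({u : V | G.Adj v u ∧ σ u = c}.ncard : ℝ) := fun c =>
    Nat.cast_nonneg _
  have hT := hle Spin.plus
  have hF := hle false
  have hT0 := h0 Spin.plus
  have hF0 := h0 false
  constructor
  · refine mul_le_mul_of_nonneg_left (Real.exp_le_exp.2 ?_) hlam.le
    nlinarith
  · refine mul_le_mul_of_nonneg_left (Real.exp_le_exp.2 ?_) hlam.le
    nlinarith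

variable {U : Finset V}

theorem pinnedConfigs_nonempty (τ : U → Spin) : (pinnedConfigs τ).Nonempty := by
  refine ⟨fun v => if h : v ∈ U then τ ⟨v, h⟩ else false, ?_⟩
  simp only [pinnedConfigs, Finset.mem_filter, Finset.mem_univ, true_and]
  exact fun v => dif_pos v.2

omit [DecidableEq V] in
theorem isingWeight_pos (G : SimpleGraph V) (β : ℝ) {lam : ℝ} (hlam : 0 < lam) (σ : V → Spin) :
    0 < isingWeight ℝ G β lam σ :=
  mul_pos (pow_pos hlam _) (by simpa using Real.exp_pos _)

theorem isingZ_pos (G : SimpleGraph V) (β : ℝ) {lam : ℝ} (hlam : 0 < lam) (τ : U → Spin) :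
    0 < isingZ ℝ G β lam τ :=
  Finset.sum_pos (fun σ _ => isingWeight_pos G β hlam σ) (pinnedConfigs_nonempty τ)

theorem isingMeasure_real_singleton (G : SimpleGraph V) (β : ℝ) {lam : ℝ} (hlam : 0 < lam)
    (τ : U → Spin) (σ : V → Spin) :
    (isingMeasure G β lam τ).real {σ} =
      if σ ∈ pinnedConfigs τ then isingWeight ℝ G β lam σ / isingZ ℝ G β lam τ else 0 := by
  rw [measureReal_def, isingMeasure, Measure.finsetSum_apply]
  simp only [Measure.smul_apply, Measure.dirac_apply, smul_eq_mul, Set.indicator_apply,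
    Set.mem_singleton_iff, Pi.one_apply, mul_ite, mul_one, mul_zero]
  rw [Finset.sum_ite_eq']
  split_ifs
  · exact ENNReal.toReal_ofReal (div_pos (isingWeight_pos G β hlam σ) (isingZ_pos G β hlam τ)).le
  · rfl

theorem isProbabilityMeasure_isingMeasure (G : SimpleGraph V) (β : ℝ) {lam : ℝ} (hlam : 0 < lam)
    (τ : U → Spin) : IsProbabilityMeasure (isingMeasure G β lam τ) := by
  constructor
  have hZ := isingZ_pos G β hlam τ
  rw [isingMeasure, Measure.finsetSum_apply]
  simp only [Measure.smul_apply, measure_univ, smul_eq_mul, mul_one]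
  rw [← ENNReal.ofReal_sum_of_nonneg fun σ _ =>
    (div_pos (isingWeight_pos G β hlam σ) hZ).le, ← Finset.sum_div]
  change ENNReal.ofReal (isingZ ℝ G β lam τ / _) = 1
  rw [div_self hZ.ne', ENNReal.ofReal_one]

/-- Tilting by `e^{zX}` multiplies the activity by `e^z`; this is how zeros of the partition
function become zeros of the moment generating function. -/
theorem complexMGF_isingMeasure (G : SimpleGraph V) (β : ℝ) {lam : ℝ} (hlam : 0 < lam)
    (τ : U → Spin) (z : ℂ) :
    complexMGF plusVar (isingMeasure G β lam τ) z =
      isingZ ℂ G β (lam * Complex.exp z) τ / isingZ ℝ G β lam τ := by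
  have := isProbabilityMeasure_isingMeasure G β hlam τ
  rw [complexMGF_eq_sum, isingZ, Finset.sum_div, ← Finset.sum_subset (Finset.subset_univ (pinnedConfigs τ))]
  · refine Finset.sum_congr rfl fun σ hσ => ?_
    rw [isingMeasure_real_singleton G β hlam, if_pos hσ, isingWeight, isingWeight, mul_pow,
      ← Complex.exp_nat_mul, plusVar]
    simp only [RCLike.ofReal_real_eq_id, id]
    push_cast
    rw [mul_comm z]
    simp only [Complex.coe_algebraMap, Complex.ofReal_exp, Complex.ofReal_mul, Complex.ofReal_natCast]
    ring
  · intro σ _ hσ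
    rw [isingMeasure_real_singleton G β hlam, if_neg hσ]
    simp

/-- The radius comes from `|e^z - 1| ≤ 2|z|` for `|z| ≤ 1`, whence `|λe^z - λ| ≤ 2b|z| < δ`. -/
theorem complexMGF_isingMeasure_ne_zero {Δ : ℕ} {G : SimpleGraph V} (hG : DegreeAtMost G Δ)
    {β lam δ b : ℝ} (hlam : 0 < lam) (hb : lam ≤ b) (hzero : AbsolutelyZeroFree.{u} Δ β δ lam)
    (τ : U → Spin) {z : ℂ} (hz : z ∈ Metric.ball (0 : ℂ) (min 1 (δ / (2 * b)))) :
    complexMGF plusVar (isingMeasure G β lam τ) z ≠ 0 := by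
  rw [complexMGF_isingMeasure G β hlam]
  refine div_ne_zero (hzero V G hG U τ _ ?_) (by exact_mod_cast (isingZ_pos G β hlam τ).ne')
  rw [mem_ball_zero_iff, lt_min_iff, lt_div_iff₀ (by linarith)] at hz
  rw [mem_ball_iff_norm]
  have h1 : (lam * Complex.exp z - lam : ℂ) = lam * (Complex.exp z - 1) := by ring
  rw [h1, norm_mul, Complex.norm_real, Real.norm_eq_abs, abs_of_pos hlam]
  calc lam * ‖Complex.exp z - 1‖ ≤ b * (2 * ‖z‖) := by
        have := Complex.norm_exp_sub_one_le hz.1.le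
        have hb0 : 0 ≤ b := by linarith
        gcongr
    _ < δ := by linarith

theorem norm_complexMGF_isingMeasure_le {G : SimpleGraph V} {β lam p t : ℝ}
    (hlam : 0 < lam) (hp : ∀ v σ, p * (1 + spinRatio G β lam v σ) ^ 2 ≤ spinRatio G β lam v σ)
    (τ : U → Spin) {I : Finset V} (hIU : Disjoint I U) (hI : ∀ u ∈ I, ∀ v ∈ I, ¬ G.Adj u v)
    (ht : |t| ≤ Real.pi) :
    ‖complexMGF plusVar (isingMeasure G β lam τ) (t * Complex.I)‖ ≤
      Real.exp (-(2 * p / Real.pi ^ 2 * t ^ 2)) ^ I.card := by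
  have := isProbabilityMeasure_isingMeasure G β hlam τ
  set μ := isingMeasure G β lam τ with hμ
  set z := Complex.exp (t * Complex.I) with hz
  have hzn : ‖z‖ = 1 := Complex.norm_exp_ofReal_mul_I t
  have hR : ∀ v σ, 0 ≤ spinRatio G β lam v σ := fun v σ => by unfold spinRatio; positivity
  have hpin : ∀ v ∈ I, ∀ σ b, Function.update σ v b ∈ pinnedConfigs τ ↔ σ ∈ pinnedConfigs τ := by
    intro v hv σ b
    simp only [pinnedConfigs, Finset.mem_filter, Finset.mem_univ, true_and]
    refine forall_congr' fun u => ?_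
    rw [Function.update_of_ne]
    intro h
    exact Finset.disjoint_left.1 hIU hv (h ▸ u.2)
  have key := norm_sum_mul_prod_le (w := fun σ => μ.real {σ}) (fun σ => measureReal_nonneg)
    (R := spinRatio G β lam) (z := z) (q := Real.exp (-(2 * p / Real.pi ^ 2 * t ^ 2)))
    (Real.exp_pos _).le I (fun v _ σ => hR v σ)
    (fun v hv u hu σ b => spinRatio_update β lam (hI v hv u hu) σ b)
    (fun v hv σ => by
      rw [isingMeasure_real_singleton G β hlam, isingMeasure_real_singleton G β hlam]
      simp only [hpin v hv]
      split_ifs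
      · rw [isingWeight_update]; ring
      · simp)
    (fun v _ σ => norm_one_add_mul_exp_le (hR v σ) (hp v σ) ht)
    -- The spins outside `I` enter through a factor of modulus `1`.
    (fun σ => ∏ v ∈ Iᶜ, (if σ v then z else 1))
    (fun u hu σ b => Finset.prod_congr rfl fun v hv => by
      rw [Function.update_of_ne]
      rintro rfl
      exact Finset.mem_compl.1 hv hu)
  have hF : ∀ σ : V → Bool, ‖∏ v ∈ Iᶜ, (if σ v then z else 1)‖ = 1 := by
    intro σ
    rw [norm_prod]
    refine Finset.prod_eq_one fun v _ => ?_
    split_ifs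
    · exact hzn
    · exact norm_one
  simp only [hF, mul_one] at key
  rw [sum_measureReal_singleton] at key
  simp only [Finset.coe_univ, probReal_univ, mul_one] at key
  rw [complexMGF_eq_sum]
  refine le_trans (le_of_eq ?_) key
  congr 1
  refine Finset.sum_congr rfl fun σ _ => ?_
  rw [mul_assoc (μ.real {σ} : ℂ), Finset.prod_compl_mul_prod, Finset.prod_ite, Finset.prod_const, Finset.prod_const_one,
    mul_one, hz, ← Complex.exp_nat_mul, mul_comm (_ : ℂ) (t * Complex.I), plusVar, plusCount]
  simp

/-- The decay constant is `2p/π²` per vertex of `I` times the density `(1 - α)/(Δ + 1)` of `I`. Here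
`p` bounds `R/(1+R)²` below through `a e^{-βΔ} ≤ R ≤ b e^{βΔ}`. -/
theorem zeroFreeCount_isingMeasure [Nonempty V] {Δ : ℕ} {β δ α a b : ℝ} (hβ : 0 ≤ β)
    (ha : 0 < a) {lam : ℝ} (hlam : lam ∈ Set.Icc a b)
    (hzero : AbsolutelyZeroFree.{u} Δ β δ lam) {G : SimpleGraph V} (hG : DegreeAtMost G Δ)
    (τ : U → Spin) (hU : (U.card : ℝ) ≤ α * Fintype.card V) :
    ZeroFreeCount (isingMeasure G β lam τ) plusCount (Fintype.card V)
      (2 * (a * Real.exp (-(β * Δ)) / (1 + b * Real.exp (β * Δ)) ^ 2) / Real.pi ^ 2 *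
        ((1 - α) / (Δ + 1))) (min 1 (δ / (2 * b))) where
  one_le := Fintype.card_pos
  le σ := Finset.card_le_univ _
  ne_zero z hz := complexMGF_isingMeasure_ne_zero hG (ha.trans_le hlam.1) hlam.2 hzero τ hz
  decay t ht := by
    have hlam0 := ha.trans_le hlam.1
    have hb : 0 < b := hlam0.trans_le hlam.2
    set p := a * Real.exp (-(β * Δ)) / (1 + b * Real.exp (β * Δ)) ^ 2 with hp
    have hp0 : 0 ≤ p := by positivity
    obtain ⟨I, hIU, hI, hcard⟩ := exists_independent_subset hG Uᶜ
    have hdisj : Disjoint I U := Finset.disjoint_left.2 fun v hv => Finset.mem_compl.1 (hIU hv)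
    refine (norm_complexMGF_isingMeasure_le (p := p) hlam0 (fun v σ => ?_) τ hdisj hI ht).trans ?_
    · obtain ⟨h1, h2⟩ := spinRatio_mem_Icc hG hβ hlam0 v σ
      have h3 : a * Real.exp (-(β * Δ)) ≤ spinRatio G β lam v σ :=
        (mul_le_mul_of_nonneg_right hlam.1 (Real.exp_pos _).le).trans h1
      have h4 : spinRatio G β lam v σ ≤ b * Real.exp (β * Δ) :=
        h2.trans (mul_le_mul_of_nonneg_right hlam.2 (Real.exp_pos _).le)
      have h5 : 0 ≤ spinRatio G β lam v σ := le_trans (by positivity) h3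
      refine le_trans ?_ h3
      rw [hp, div_mul_eq_mul_div, div_le_iff₀ (by positivity)]
      gcongr
    · rw [← Real.exp_nat_mul, Real.exp_le_exp]
      have hc1 : ((1 - α) / (Δ + 1)) * Fintype.card V ≤ I.card := by
        rw [div_mul_eq_mul_div, div_le_iff₀ (by positivity)]
        rw [Finset.card_compl] at hcard
        have h6 : (Fintype.card V : ℝ) ≤ I.card * (Δ + 1) + U.card := by
          exact_mod_cast Nat.sub_le_iff_le_add.1 hcard
        linarith
      have h7 : 0 ≤ 2 * p / Real.pi ^ 2 * t ^ 2 := by positivity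
      nlinarith [mul_le_mul_of_nonneg_right hc1 h7]

end Ising

/-! ### The first correction at bounded distance from the mean. -/

/-- For `d = 1` only `j = 3` occurs and `k_3 ≤ 2`, so only `H_3` and `H_6` survive. -/
theorem edgeworthCorrection_one {Ω : Type u} [MeasurableSpace Ω] (X : Ω → ℝ) (μ : Measure Ω)
    (x : ℝ) :
    edgeworthCorrection X μ 1 x = (x ^ 3 - 3 * x) * normCumulant X μ 3 +
      (x ^ 6 - 15 * x ^ 4 + 45 * x ^ 2 - 15) * (normCumulant X μ 3 ^ 2 / 2) := by
  let _ : Unique (Finset.Icc 3 (2 * 1 + 1)) :=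
    { default := ⟨3, by simp⟩
      uniq := fun ⟨j, hj⟩ => Subtype.ext (by simp only [Finset.mem_Icc] at hj ⊢; omega) }
  have hdef : ((default : Finset.Icc 3 (2 * 1 + 1)) : ℕ) = 3 := rfl
  have hmem : ∀ (r : ℕ) (k : Finset.Icc 3 (2 * 1 + 1) → ℕ), k ∈ edgeworthTuples 1 r ↔
      k default * 3 = r ∧ k default ≤ 2 := by
    intro r k
    rw [mem_edgeworthTuples, isEdgeworthTuple_iff, Fintype.sum_unique, Fintype.sum_unique, hdef]
    omega
  have hsingle : ∀ i ≤ 2, edgeworthTuples 1 (i * 3) = {fun _ => i} := by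
    intro i hi
    ext k
    rw [hmem, Finset.mem_singleton, funext_iff, Unique.forall_iff]
    omega
  have hempty : ∀ r, ¬ 3 ∣ r → edgeworthTuples 1 r = ∅ := by
    intro r hr
    rw [Finset.eq_empty_iff_forall_notMem]
    intro k hk
    rw [hmem] at hk
    exact hr ⟨k default, by omega⟩
  have h3 := hsingle 1 (by norm_num)
  have h6 := hsingle 2 le_rfl
  have h4 := hempty 4 (by norm_num)
  have h5 := hempty 5 (by norm_num)
  norm_num at h3 h6
  have hH : ∀ r, Polynomial.aeval x (Polynomial.hermite (r + 1)) =
      x * Polynomial.aeval x (Polynomial.hermite r) -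
        Polynomial.aeval x (Polynomial.derivative (Polynomial.hermite r)) := by
    intro r
    simp [Polynomial.hermite_succ]
  have hIcc : Finset.Icc 3 (6 * 1) = {3, 4, 5, 6} := by decide
  rw [edgeworthCorrection, hIcc]
  simp only [Finset.mem_insert, Finset.mem_singleton, Finset.sum_insert, Finset.sum_singleton,
    Nat.reduceEqDiff, or_self, not_false_eq_true, h3, h4, h5, h6,
    Finset.sum_empty, mul_zero, Fintype.prod_unique, hdef]
  have e3 : Polynomial.aeval x (Polynomial.hermite 3) = x ^ 3 - 3 * x := by
    simp [Polynomial.hermite_succ]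
    ring
  have e6 : Polynomial.aeval x (Polynomial.hermite 6) = x ^ 6 - 15 * x ^ 4 + 45 * x ^ 2 - 15 := by
    simp [Polynomial.hermite_succ]
    ring
  rw [e3, e6]
  norm_num

/-- At bounded distance from the mean the first correction is of order `n^{-3/2}`. -/
theorem exists_gaussianDensity_mul_edgeworthCorrection_one_bound {c r : ℝ} (hc : 0 < c)
    (hr : 0 < r) (L : ℝ) (hL : 0 ≤ L) :
    ∃ K : ℝ, ∀ (Ω : Type u) [Fintype Ω] [MeasurableSpace Ω] [MeasurableSingletonClass Ω]
      (μ : Measure Ω) [IsProbabilityMeasure μ] (N : Ω → ℕ) (n : ℕ), ZeroFreeCount μ N n c r →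
      ∀ l : ℝ, |l| ≤ L → |gaussianDensity √(variance (fun ω => (N ω : ℝ)) μ) l *
          edgeworthCorrection (fun ω => (N ω : ℝ)) μ 1
            (l / √(variance (fun ω => (N ω : ℝ)) μ))| ≤ K / √n ^ 3 := by
  -- The constants are chosen so that `s ≥ κ√n`, `|l/s| ≤ M/√n` and `|β_3| ≤ B/√n`.
  set κ : ℝ := √(2 * c) with hκ
  have hκ0 : 0 < κ := by positivity
  set M : ℝ := L / κ with hM
  have hM0 : 0 ≤ M := by positivity
  set B : ℝ := 2 * r / (r / 2) ^ 3 / κ ^ 3 with hB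
  have hB0 : 0 ≤ B := by positivity
  refine ⟨1 / κ * (M * (M ^ 2 + 3) * B + (M ^ 6 + 15 * M ^ 4 + 45 * M ^ 2 + 15) * B ^ 2), ?_⟩
  intro Ω _ _ _ μ _ N n h l hl
  have hn1 : (1 : ℝ) ≤ n := by exact_mod_cast h.one_le
  set s : ℝ := √(variance (fun ω => (N ω : ℝ)) μ) with hs
  set ν : ℝ := √(n : ℝ) with hν
  have hν1 : 1 ≤ ν := Real.one_le_sqrt.2 hn1
  have hν0 : 0 < ν := by linarith
  have hνsq : ν ^ 2 = n := Real.sq_sqrt (by linarith)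
  have hsκ : κ * ν ≤ s := by
    rw [hκ, hν, ← Real.sqrt_mul (by positivity)]
    exact Real.sqrt_le_sqrt (by linarith [h.variance_ge hc])
  have hs0 : 0 < s := lt_of_lt_of_le (by positivity) hsκ
  set x := l / s with hx
  have hxM : |x| ≤ M / ν := by
    rw [hx, abs_div, abs_of_pos hs0, hM, div_div]
    gcongr
  have hxM1 : |x| ≤ M := hxM.trans (div_le_self hM0 hν1)
  have hβ3 : |normCumulant (fun ω => (N ω : ℝ)) μ 3| ≤ B / ν := by
    have h1 := (h.cumulant_expansion hr).1 3
    rw [normCumulant, ← div_div, abs_div, abs_of_pos (pow_pos hs0 3)]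
    calc _ ≤ 2 * (n * r) / (r / 2) ^ 3 / (κ * ν) ^ 3 := by gcongr
      _ = B / ν := by
        rw [hB, ← hνsq]
        field_simp
  set b := normCumulant (fun ω => (N ω : ℝ)) μ 3 with hb
  have hg : |gaussianDensity s l| ≤ 1 / (κ * ν) := by
    have h2 : 1 ≤ √(2 * Real.pi) := Real.one_le_sqrt.2 (by linarith [Real.pi_gt_three])
    rw [gaussianDensity, abs_of_nonneg (by positivity)]
    refine div_le_div₀ zero_le_one ?_ (by positivity) ?_
    · exact Real.exp_le_one_iff.2 (neg_nonpos.2 (by positivity))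
    · exact hsκ.trans (le_mul_of_one_le_left hs0.le h2)
  -- `H_3` is odd, so it supplies the second factor `n^{-1/2}`. In `hE2` both factors come from
  -- `β_3²`, and `H_6` need only be bounded.
  have hE1 : |(x ^ 3 - 3 * x) * b| ≤ M * (M ^ 2 + 3) * B / n := by
    have h3 : |x ^ 3 - 3 * x| ≤ M / ν * (M ^ 2 + 3) := by
      rw [show x ^ 3 - 3 * x = x * (x ^ 2 - 3) by ring, abs_mul]
      refine mul_le_mul hxM ?_ (abs_nonneg _) (by positivity)
      refine (abs_sub _ _).trans ?_
      rw [abs_pow, abs_of_pos (by norm_num : (0 : ℝ) < 3)]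
      gcongr
    rw [abs_mul, ← hνsq]
    calc _ ≤ M / ν * (M ^ 2 + 3) * (B / ν) :=
          mul_le_mul h3 hβ3 (abs_nonneg _) (by positivity)
      _ = _ := by field_simp
  have hE2 : |(x ^ 6 - 15 * x ^ 4 + 45 * x ^ 2 - 15) * (b ^ 2 / 2)| ≤
      (M ^ 6 + 15 * M ^ 4 + 45 * M ^ 2 + 15) * B ^ 2 / n := by
    have h6 : |x ^ 6 - 15 * x ^ 4 + 45 * x ^ 2 - 15| ≤ M ^ 6 + 15 * M ^ 4 + 45 * M ^ 2 + 15 := by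
      have p2 : x ^ 2 ≤ M ^ 2 := by rw [← sq_abs]; gcongr
      have p4 : x ^ 4 ≤ M ^ 4 := by
        rw [← Even.pow_abs (by decide : Even 4)]; gcongr
      have p6 : x ^ 6 ≤ M ^ 6 := by
        rw [← Even.pow_abs (by decide : Even 6)]; gcongr
      have q2 : 0 ≤ x ^ 2 := by positivity
      have q4 : 0 ≤ x ^ 4 := by positivity
      have q6 : 0 ≤ x ^ 6 := by positivity
      rw [abs_le]
      constructor <;> linarith
    have h7 : |b ^ 2 / 2| ≤ (B / ν) ^ 2 := by
      rw [abs_of_nonneg (by positivity), ← sq_abs b]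
      exact (half_le_self (by positivity)).trans (by gcongr)
    rw [abs_mul, ← hνsq]
    calc _ ≤ (M ^ 6 + 15 * M ^ 4 + 45 * M ^ 2 + 15) * (B / ν) ^ 2 :=
          mul_le_mul h6 h7 (abs_nonneg _) (by positivity)
      _ = _ := by field_simp
  rw [edgeworthCorrection_one, abs_mul]
  calc _ ≤ 1 / (κ * ν) * (M * (M ^ 2 + 3) * B / n +
        (M ^ 6 + 15 * M ^ 4 + 45 * M ^ 2 + 15) * B ^ 2 / n) :=
        mul_le_mul hg ((abs_add_le _ _).trans (add_le_add hE1 hE2)) (abs_nonneg _) (by positivity)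
    _ = _ := by
        rw [← hνsq]
        field_simp

/-! ### Uniform constants and the main theorem. -/

/-- Compactness enters only through the least and greatest elements of `D`, which serve as `a` and
`b`. -/
theorem exists_zeroFreeCount_constants (Δ : ℕ) (β : ℝ) (hβ : 0 ≤ β) (D : Set ℝ) (hD : IsCompact D)
    (hDpos : ∀ lam ∈ D, 0 < lam) (δ : ℝ) (hδ : 0 < δ)
    (hzero : ∀ lam ∈ D, AbsolutelyZeroFree.{u} Δ β δ lam) (α : ℝ) (hα' : α < 1) :
    ∃ c r : ℝ, 0 < c ∧ 0 < r ∧ ∀ lam ∈ D,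
      ∀ (V : Type u) [Fintype V] [DecidableEq V] [Nonempty V] (G : SimpleGraph V),
      DegreeAtMost G Δ → ∀ (U : Finset V) (τ : U → Spin), (U.card : ℝ) ≤ α * Fintype.card V →
      ZeroFreeCount (isingMeasure G β lam τ) plusCount (Fintype.card V) c r := by
  rcases D.eq_empty_or_nonempty with rfl | hne
  · exact ⟨1, 1, one_pos, one_pos, fun lam h => absurd h (Set.notMem_empty _)⟩
  obtain ⟨a, haD, ha⟩ := hD.exists_isLeast hne
  obtain ⟨b, hbD, hb⟩ := hD.exists_isGreatest hne
  have ha0 := hDpos a haD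
  have hb0 := hDpos b hbD
  refine ⟨_, _, ?_, ?_, fun lam hlam V _ _ _ G hG U τ hU => zeroFreeCount_isingMeasure hβ ha0
    ⟨ha hlam, hb hlam⟩ (hzero lam hlam) hG τ hU⟩
  · have : 0 < 1 - α := by linarith
    positivity
  · positivity

theorem mainTheorem8 (Δ : ℕ) (β : ℝ) (hβ : 0 ≤ β) (D : Set ℝ) (hD : IsCompact D)
    (hDpos : ∀ lam ∈ D, 0 < lam) (δ : ℝ) (hδ : 0 < δ)
    (hzero : ∀ lam ∈ D, AbsolutelyZeroFree.{u} Δ β δ lam)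
    (α : ℝ) (hα : 0 ≤ α) (hα' : α < 1) :
    (∀ d : ℕ, ∃ C : ℝ, ∀ lam ∈ D,
      ∀ (V : Type u) [Fintype V] [DecidableEq V] [Nonempty V] (G : SimpleGraph V),
      DegreeAtMost G Δ →
      ∀ (U : Finset V) (τ : U → Spin), (U.card : ℝ) ≤ α * Fintype.card V →
      ∀ (μ : Measure (V → Spin)), μ = isingMeasure G β lam τ →
      ∀ (s : ℝ), s = √(variance plusVar μ) →
      ∀ ℓ : ℝ, (∃ m : ℕ, (∫ σ, plusVar σ ∂μ) + ℓ = m) →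
        |μ.real {σ | plusVar σ - (∫ σ, plusVar σ ∂μ) = ℓ} -
            gaussianDensity s ℓ * (1 + edgeworthCorrection plusVar μ d (ℓ / s))|
          ≤ C * (Fintype.card V : ℝ) ^ (-(d : ℝ))) ∧
    (∀ L : ℕ, ∃ C : ℝ, ∀ lam ∈ D,
      ∀ (V : Type u) [Fintype V] [DecidableEq V] [Nonempty V] (G : SimpleGraph V),
      DegreeAtMost G Δ →
      ∀ (U : Finset V) (τ : U → Spin), (U.card : ℝ) ≤ α * Fintype.card V →
      ∀ (μ : Measure (V → Spin)), μ = isingMeasure G β lam τ →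
      ∀ (s : ℝ), s = √(variance plusVar μ) →
      ∀ ℓ : ℝ, (∃ m : ℕ, (∫ σ, plusVar σ ∂μ) + ℓ = m) → |ℓ| ≤ L →
        |μ.real {σ | plusVar σ - (∫ σ, plusVar σ ∂μ) = ℓ} - gaussianDensity s ℓ|
          ≤ C * (Fintype.card V : ℝ) ^ (-(3 / 2 : ℝ))) := by
  obtain ⟨c, r, hc, hr, hcount⟩ :=
    exists_zeroFreeCount_constants Δ β hβ D hD hDpos δ hδ hzero α hα'
  have hset : ∀ {V : Type u} [Fintype V] {E ℓ : ℝ} {m : ℕ}, E + ℓ = m →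
      {σ : V → Spin | plusVar σ - E = ℓ} = {σ | plusCount σ = m} := by
    intro V _ E ℓ m h
    ext σ
    change plusVar σ - E = ℓ ↔ plusCount σ = m
    rw [sub_eq_iff_eq_add', h, plusVar, Nat.cast_inj]
  constructor
  · intro d
    obtain ⟨K, hK0, hK⟩ := exists_local_limit_bound.{u} hc hr d
    refine ⟨K, ?_⟩
    rintro lam hlam V _ _ _ G hG U τ hU μ rfl s rfl ℓ ⟨m, hm⟩
    have hprob := isProbabilityMeasure_isingMeasure G β (hDpos lam hlam) τ
    rw [hset hm]
    refine (hK _ _ _ _ (hcount lam hlam V G hG U τ hU) m ℓ hm).trans ?_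
    have hn1 : (1 : ℝ) ≤ Fintype.card V := by exact_mod_cast Fintype.card_pos
    have hsn : 1 ≤ √(Fintype.card V : ℝ) := Real.one_le_sqrt.2 hn1
    rw [Real.rpow_neg (by linarith), Real.rpow_natCast, ← div_eq_mul_inv]
    gcongr
    -- The local limit error is `n^{-d-1/2}`, half a power better than required.
    calc (Fintype.card V : ℝ) ^ d = √(Fintype.card V : ℝ) ^ (2 * d) := by
          rw [pow_mul, Real.sq_sqrt (by linarith)]
      _ ≤ _ := pow_le_pow_right₀ hsn (by omega)
  · intro L
    -- Order `1` suffices: its error is exactly `n^{-3/2}`.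
    obtain ⟨K, hK0, hK⟩ := exists_local_limit_bound.{u} hc hr 1
    obtain ⟨K', hK'⟩ := exists_gaussianDensity_mul_edgeworthCorrection_one_bound.{u} hc hr (L : ℝ)
      (Nat.cast_nonneg L)
    refine ⟨K + K', ?_⟩
    rintro lam hlam V _ _ _ G hG U τ hU μ rfl s rfl ℓ ⟨m, hm⟩ hℓ
    have hprob := isProbabilityMeasure_isingMeasure G β (hDpos lam hlam) τ
    have hcnt := hcount lam hlam V G hG U τ hU
    rw [hset hm]
    have h1 := hK _ _ _ _ hcnt m ℓ hm
    have h2 := hK' _ _ _ _ hcnt ℓ hℓ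
    have hpow : (Fintype.card V : ℝ) ^ (-(3 / 2 : ℝ)) = (√(Fintype.card V : ℝ) ^ 3)⁻¹ := by
      rw [Real.rpow_neg (Nat.cast_nonneg _), Real.sqrt_eq_rpow, ← Real.rpow_mul_natCast
        (Nat.cast_nonneg _)]
      norm_num
    rw [hpow, ← div_eq_mul_inv, add_div]
    refine le_trans ?_ (add_le_add h1 h2)
    refine le_trans (le_of_eq ?_) (abs_add_le _ _)
    congr 1
    change _ = _ - gaussianDensity √(variance plusVar _) ℓ * (1 + edgeworthCorrection plusVar _ 1 _) +
      gaussianDensity √(variance plusVar _) ℓ * edgeworthCorrection plusVar _ 1 _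
    ring
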